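/- Let $n\ge 0$, let $\Gamma=\{1,\dots,m\}$ be a finite index set with the discrete topology, let $f_\gamma:\mathbb R^n\to\mathbb R^n$ ($\gamma\in\Gamma$) be continuous, write $f(\xi,\gamma)=f_\gamma(\xi)$, and let $|\cdot|$ be the Euclidean norm. A *switching signal* is a right-continuous piecewise constant map $\sigma:[0,\infty)\to\Gamma$ (with finitely many discontinuities in every bounded interval); its *switching times* are $t_0=0$ and its consecutive discontinuities $t_1<t_2<\cdots$. A *solution* of $\dot x=f(x,\sigma)$ on $I=[0,T)$ or $I=[0,T]$ is a continuous, piecewise $C^1$ curve $x:I\to\mathbb R^n$ with $\dot x(t)=f(x(t),\sigma(t))$ for every $t\in I$ that is not a switching time (a one-sided derivative at an end point $T \in I$). Let $\mathcal T$ be the set of all *maximal trajectories*, i.e. of all pairs $(x,\sigma)$ where $\sigma$ is a switching signal and $x$ is a maximal (non-extendable) solution with domain $\mathcal I_{(x,\sigma)}=[0,t_{(x,\sigma)})$, $0<t_{(x,\sigma)}\le\infty$. Let $\chi=\{\chi_\gamma\}_{\gamma\in\Gamma}$ be a covering of $\mathbb R^n$ by closed sets, $\Gamma^*=\{\gamma\in\Gamma: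 0\in\chi_\gamma\}$, and suppose $f(0,\gamma)=0$ for all $\gamma\in\Gamma^*$. Let $\mathcal T[\chi]$ be the set of all $(x,\sigma)\in\mathcal T$ with $x(t)\in\chi_{\sigma(t)}$ for all $t\in\mathcal I_{(x,\sigma)}$. For $\tau_D>0$ and an integer $N_0\ge 1$ let $\mathcal T_a[\tau_D,N_0]$ be the set of all $(x,\sigma)\in\mathcal T$ such that $\sigma$ has at most $N_0+(\tau_2-\tau_1)/\tau_D$ switching times in every open interval $(\tau_1,\tau_2)$ with $0\le\tau_1<\tau_2<\infty$, and let $\mathcal T_a=\bigcup_{\tau_D>0,N_0\ge 1}\mathcal T_a[\tau_D,N_0]$. Let $\mathcal T'\subseteq\mathcal T[\chi]\cap\mathcal T_a$ be any family of trajectories. A map $V:\mathbb R^n\times\Gamma\to\mathbb R$ is a *weak Lyapunov-like function* for $\mathcal T'$ if it is continuously differentiable in the first argument and 1. there are $\alpha_1,\alpha_2$ of class $\mathcal K_\infty$ (continuous, strictly increasing, unbounded maps $[0,\infty)\to[0,\infty)$ vanishing at $0$) with $\alpha_1(|\xi|)\le V(\xi,\gamma)\le\alpha_2(|\xi|)$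 whenever $\xi\in\chi_\gamma$; 2. $\frac{\partial V}{\partial\xi}(\xi,\gamma)f(\xi,\gamma)\le 0$ whenever $\xi\in\chi_\gamma$; 3. for every $(x,\sigma)\in\mathcal T'$ and all switching times $t_i<t_j$ in the domain of $x$ with $\sigma(t_i)=\sigma(t_j)$, $V(x(t_j),\sigma(t_j))\le V(x(t_{i+1}),\sigma(t_i))$. Let $\mathcal T_V^*$ be the set of all $(x,\sigma)\in\mathcal T$ such that $V(x(t),\sigma(t))=V(x(t'),\sigma(t'))$ for all $t,t'\in\mathcal I_{(x,\sigma)}$ with $\sigma(t)=\sigma(t')$. A nonempty set $M\subseteq\mathbb R^n\times\Gamma$ is *weakly invariant* with respect to a family $\mathcal T^*\subseteq\mathcal T$ if for each $(\xi,\gamma)\in M$ there is $(x,\sigma)\in\mathcal T^*$ with $x(0)=\xi$, $\sigma(0)=\gamma$ and $(x(t),\sigma(t))\in M$ for all $t\in\mathcal I_{(x,\sigma)}$. **Theorem.** Suppose that there is a weak Lyapunov-like function $V$ for $\mathcal T'$ such that $\{0\}\times\Gamma^*$ is the maximal (largest) weakly invariant set with respect to $\mathcal T_V^*\cap\mathcal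 T[\chi]\cap\mathcal T_a$. Then $\mathcal T'$ is *globally asymptotically stable*: all members of $\mathcal T'$ are defined on $[0,\infty)$; there is $\alpha$ of class $\mathcal K_\infty$ such that $|x(t)|\le\alpha(|x(t_0)|)$ for all $(x,\sigma)\in\mathcal T'$ and all $t\ge t_0\ge 0$; and $x(t)\to 0$ as $t\to\infty$ for every $(x,\sigma)\in\mathcal T'$. If in addition $\mathcal T'\subseteq\mathcal T_a[\tau_D,N_0]$ for some $\tau_D>0$ and some integer $N_0\ge 1$, then $\mathcal T'$ is *globally uniformly asymptotically stable*: there is a function $\beta:[0,\infty)^2\to[0,\infty)$, of class $\mathcal K_\infty$ in the first argument and decreasing (in the non-strict sense) to $0$ in the second one, such that $|x(t)|\le\beta(|x(t_0)|,t-t_0)$ for all $(x,\sigma)\in\mathcal T'$ and all $t\ge t_0\ge 0$. -/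

import Mathlib

open Set Filter Topology
open scoped NNReal

namespace Switched

/-! ### Comparison functions -/

/-- Class `K_∞`: strictly increasing, continuous, zero at zero, unbounded maps `ℝ₊ → ℝ₊`. -/
structure IsClassKInfty (α : ℝ≥0 → ℝ≥0) : Prop where
  strictMono : StrictMono α
  continuous : Continuous α
  map_zero : α 0 = 0
  unbounded : ¬ BddAbove (range α)

/-- Class `KL`: of class `K_∞` in the first argument, decreasing to zero in the second one. -/
structure IsClassKL (β : ℝ≥0 → ℝ≥0 → ℝ≥0) : Prop where
  classKInfty : ∀ s, IsClassKInfty (fun r => β r s)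
  antitone : ∀ r, Antitone (β r)
  tendsto_zero : ∀ r, Tendsto (β r) atTop (𝓝 0)

/-! ### Switching signals

A signal `ℝ₊ → {1, …, m}` is represented by a function on `ℝ`, whose values at negative
times play no role. The index set `Fin m` carries the discrete topology. -/

/-- The discontinuities of `σ` at positive times. -/
def discontinuities {m : ℕ} (σ : ℝ → Fin m) : Set ℝ :=
  {t | 0 < t ∧ ¬ ContinuousAt σ t}

/-- The switching times `t₀ = 0 < t₁ < t₂ < …`. -/
def switchingTimes {m : ℕ} (σ : ℝ → Fin m) : Set ℝ :=
  insert 0 (discontinuities σ)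

/-- `σ` is continuous from the right and piecewise constant on `ℝ₊`: it has finitely many
discontinuities in each bounded interval (between two of them it is continuous, hence constant). -/
structure IsSwitchingSignal {m : ℕ} (σ : ℝ → Fin m) : Prop where
  right_continuous : ∀ t, 0 ≤ t → ContinuousWithinAt σ (Ici t) t
  locally_finite : ∀ b : ℝ, (discontinuities σ ∩ Iic b).Finite

/-- `σ` has average dwell-time `τ` and chatter bound `N`. -/
def HasAverageDwellTime {m : ℕ} (τ : ℝ) (N : ℕ) (σ : ℝ → Fin m) : Prop :=
  ∀ a b : ℝ, 0 ≤ a → a < b →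
    ((discontinuities σ ∩ Ioo a b).ncard : ℝ) ≤ N + (b - a) / τ

/-! ### Solutions and trajectories -/

/-- The intervals `[0, T)`, `[0, T]` with `0 < T < ∞`, and `[0, ∞)`. -/
def IsTimeInterval (I : Set ℝ) : Prop :=
  (∃ T : ℝ, 0 < T ∧ (I = Ico 0 T ∨ I = Icc 0 T)) ∨ I = Ici 0

/-- `x` is a solution on `I` of `x' = f_σ(x)`: it is continuous on `I` and satisfies the equation
at all times of `I` that are not switching times. The derivative is taken within `I`, that is,
it is one-sided at a right end point belonging to `I`. -/
structure IsSolution {n m : ℕ}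
    (f : Fin m → EuclideanSpace ℝ (Fin n) → EuclideanSpace ℝ (Fin n))
    (σ : ℝ → Fin m) (I : Set ℝ) (x : ℝ → EuclideanSpace ℝ (Fin n)) : Prop where
  continuousOn : ContinuousOn x I
  hasDeriv : ∀ t ∈ I, t ∉ switchingTimes σ → HasDerivWithinAt x (f (σ t) (x t)) I t

/-- The data of a pair `(x, σ)` together with the end point `T ∈ (0, ∞]` of the domain `[0, T)`
of `x`. Values of `x` outside of the domain play no role. -/
structure Traj (n m : ℕ) where
  /-- the curve -/
  x : ℝ → EuclideanSpace ℝ (Fin n)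
  /-- the switching signal -/
  σ : ℝ → Fin m
  /-- the end point of the domain -/
  T : EReal

/-- The domain `[0, T)`. -/
def Traj.dom {n m : ℕ} (p : Traj n m) : Set ℝ :=
  {t | 0 ≤ t ∧ (t : EReal) < p.T}

/-- `p` is a maximal trajectory: `p.σ` is a switching signal, and `p.x` is a solution on
`[0, T)` that has no extension to a solution on a larger interval. -/
structure Traj.IsMaximal {n m : ℕ}
    (f : Fin m → EuclideanSpace ℝ (Fin n) → EuclideanSpace ℝ (Fin n))
    (p : Traj n m) : Prop where
  isSwitchingSignal : IsSwitchingSignal p.σ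
  pos : 0 < p.T
  isSolution : IsSolution f p.σ p.dom p.x
  not_extendable : ∀ (J : Set ℝ) (y : ℝ → EuclideanSpace ℝ (Fin n)),
    IsTimeInterval J → IsSolution f p.σ J y → p.dom ⊆ J → EqOn p.x y p.dom → J ⊆ p.dom

/-- All maximal trajectories. -/
def maximalTrajs {n m : ℕ}
    (f : Fin m → EuclideanSpace ℝ (Fin n) → EuclideanSpace ℝ (Fin n)) : Set (Traj n m) :=
  {p | p.IsMaximal f}

/-- `𝒯[χ]`: the maximal trajectories with `x(t) ∈ χ_{σ(t)}`. -/
def coveredTrajs {n m : ℕ}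
    (f : Fin m → EuclideanSpace ℝ (Fin n) → EuclideanSpace ℝ (Fin n))
    (χ : Fin m → Set (EuclideanSpace ℝ (Fin n))) : Set (Traj n m) :=
  {p ∈ maximalTrajs f | ∀ t ∈ p.dom, p.x t ∈ χ (p.σ t)}

/-- `𝒯_a[τ, N]`: the maximal trajectories whose signal has average dwell-time `τ` and chatter
bound `N`. -/
def dwellTrajs {n m : ℕ}
    (f : Fin m → EuclideanSpace ℝ (Fin n) → EuclideanSpace ℝ (Fin n))
    (τ : ℝ) (N : ℕ) : Set (Traj n m) :=
  {p ∈ maximalTrajs f | HasAverageDwellTime τ N p.σ}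

/-- `𝒯_a`: the union of the `𝒯_a[τ, N]` over `τ > 0` and `N > 0`. -/
def averageDwellTrajs {n m : ℕ}
    (f : Fin m → EuclideanSpace ℝ (Fin n) → EuclideanSpace ℝ (Fin n)) : Set (Traj n m) :=
  {p | ∃ (τ : ℝ) (N : ℕ), 0 < τ ∧ 0 < N ∧ p ∈ dwellTrajs f τ N}

/-- `𝒯_V`: `V(x, σ)` does not increase between times with the same mode. -/
def nonincreasingTrajs {n m : ℕ}
    (f : Fin m → EuclideanSpace ℝ (Fin n) → EuclideanSpace ℝ (Fin n))
    (V : EuclideanSpace ℝ (Fin n) → Fin m → ℝ) : Set (Traj n m) :=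
  {p ∈ maximalTrajs f | ∀ t ∈ p.dom, ∀ t' ∈ p.dom, t ≤ t' → p.σ t = p.σ t' →
    V (p.x t') (p.σ t') ≤ V (p.x t) (p.σ t)}

/-- `𝒯_V^*`: the members of `𝒯_V` for which `V(x, σ)` is the same at all times with the same
mode. -/
def constantTrajs {n m : ℕ}
    (f : Fin m → EuclideanSpace ℝ (Fin n) → EuclideanSpace ℝ (Fin n))
    (V : EuclideanSpace ℝ (Fin n) → Fin m → ℝ) : Set (Traj n m) :=
  {p ∈ nonincreasingTrajs f V | ∀ t ∈ p.dom, ∀ t' ∈ p.dom, p.σ t = p.σ t' →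
    V (p.x t) (p.σ t) = V (p.x t') (p.σ t')}

/-! ### Coverings, weak Lyapunov-like functions, weak invariance -/

/-- `χ` is a covering of `ℝⁿ` by closed sets. -/
structure IsClosedCovering {n m : ℕ} (χ : Fin m → Set (EuclideanSpace ℝ (Fin n))) : Prop where
  isClosed : ∀ γ, IsClosed (χ γ)
  covers : ⋃ γ, χ γ = univ

/-- `Γ*`: the modes `γ` with `0 ∈ χ_γ`. -/
def zeroModes {n m : ℕ} (χ : Fin m → Set (EuclideanSpace ℝ (Fin n))) : Set (Fin m) :=
  {γ | 0 ∈ χ γ}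

/-- `V` is a weak Lyapunov-like function for the family `F`. In `switch`, `s` and `t` are
switching times `t_i < t_j` (in the domain) and `u` is `t_{i+1}`. -/
structure IsWeakLyapunovLike {n m : ℕ}
    (f : Fin m → EuclideanSpace ℝ (Fin n) → EuclideanSpace ℝ (Fin n))
    (χ : Fin m → Set (EuclideanSpace ℝ (Fin n)))
    (F : Set (Traj n m)) (V : EuclideanSpace ℝ (Fin n) → Fin m → ℝ) : Prop where
  contDiff : ∀ γ, ContDiff ℝ 1 (fun ξ => V ξ γ)
  bounds : ∃ α₁ α₂ : ℝ≥0 → ℝ≥0, IsClassKInfty α₁ ∧ IsClassKInfty α₂ ∧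
    ∀ γ, ∀ ξ ∈ χ γ, (α₁ ‖ξ‖₊ : ℝ) ≤ V ξ γ ∧ V ξ γ ≤ (α₂ ‖ξ‖₊ : ℝ)
  deriv_nonpos : ∀ γ, ∀ ξ ∈ χ γ, fderiv ℝ (fun ζ => V ζ γ) ξ (f γ ξ) ≤ 0
  switch : ∀ p ∈ F, ∀ s ∈ switchingTimes p.σ, ∀ t ∈ switchingTimes p.σ, t ∈ p.dom → s < t →
    p.σ s = p.σ t → ∀ u, IsLeast {u | u ∈ switchingTimes p.σ ∧ s < u} u →
    V (p.x t) (p.σ t) ≤ V (p.x u) (p.σ s)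

/-- `M` is weakly invariant with respect to the family `F`. -/
def IsWeaklyInvariant {n m : ℕ} (F : Set (Traj n m))
    (M : Set (EuclideanSpace ℝ (Fin n) × Fin m)) : Prop :=
  M.Nonempty ∧ ∀ q ∈ M, ∃ p ∈ F, p.x 0 = q.1 ∧ p.σ 0 = q.2 ∧ ∀ t ∈ p.dom, (p.x t, p.σ t) ∈ M

/-- `M` is the maximal (largest) weakly invariant set with respect to `F`. -/
def IsMaximalWeaklyInvariant {n m : ℕ} (F : Set (Traj n m))
    (M : Set (EuclideanSpace ℝ (Fin n) × Fin m)) : Prop :=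
  IsGreatest {M' | IsWeaklyInvariant F M'} M

/-! ### Stability

The estimates are for all `t ≥ t₀ ≥ 0`, so that the members of a stable family have to be
defined on all of `[0, ∞)`; this is stated explicitly. -/

/-- Uniform stability of a family. -/
def UniformlyStable {n m : ℕ} (F : Set (Traj n m)) : Prop :=
  ∃ α : ℝ≥0 → ℝ≥0, IsClassKInfty α ∧ ∀ p ∈ F, p.T = ⊤ ∧
    ∀ t₀ t : ℝ, 0 ≤ t₀ → t₀ ≤ t → ‖p.x t‖₊ ≤ α ‖p.x t₀‖₊

/-- Global asymptotic stability of a family. -/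
def GloballyAsymptoticallyStable {n m : ℕ} (F : Set (Traj n m)) : Prop :=
  UniformlyStable F ∧ ∀ p ∈ F, p.T = ⊤ ∧ Tendsto p.x atTop (𝓝 0)

/-- Global uniform asymptotic stability of a family. -/
def GloballyUniformlyAsymptoticallyStable {n m : ℕ} (F : Set (Traj n m)) : Prop :=
  ∃ β : ℝ≥0 → ℝ≥0 → ℝ≥0, IsClassKL β ∧ ∀ p ∈ F, p.T = ⊤ ∧
    ∀ t₀ t : ℝ, 0 ≤ t₀ → t₀ ≤ t → ‖p.x t‖₊ ≤ β ‖p.x t₀‖₊ (t - t₀).toNNReal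

end Switched

/-!
Along a covered trajectory on which `V` is nonincreasing within each mode, the norm grows by at most
a fixed gain `ρ` of class `K∞` between two visits to the same mode. Passing from one mode to the
next, always after the last visit, costs at most one gain per mode, so `‖x t‖ ≤ ρ^[m] ‖x s‖`
however often the signal switches.

For a fixed dwell time and chatter bound, uniformly bounded trajectories have limits along
ultrafilters: switching times can only accumulate at isolated times, the curves are equi-Lipschitz,
and the limit is again a trajectory with the same bounds. A limit of time shifts of one trajectory
has `V` constant in each mode, so its orbit is weakly invariant and hence lies over `0`. This gives
attractivity, and the same compactness applied to a sequence of trajectories that stay away from `0`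
longer and longer makes it uniform.
-/

namespace Switched

/-! ### Comparison functions -/

namespace IsClassKInfty

variable {α β : ℝ≥0 → ℝ≥0}

theorem surjective (hα : IsClassKInfty α) : Function.Surjective α := by
  intro y
  have exists_ge : ∃ x, y ≤ α x := by
    by_contra! hlt
    exact hα.unbounded ⟨y, forall_mem_range.2 fun x => (hlt x).le⟩
  exact mem_range_of_exists_le_of_exists_ge hα.continuous ⟨0, by simp [hα.map_zero]⟩ exists_ge

theorem of_surjective (hmono : StrictMono α) (hsurj : Function.Surjective α) :
    IsClassKInfty α where
  strictMono := hmono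
  continuous := (hmono.orderIsoOfSurjective α hsurj).continuous
  map_zero := (hmono.orderIsoOfSurjective α hsurj).map_bot
  unbounded := hsurj.range_eq ▸ not_bddAbove_univ

theorem comp (hα : IsClassKInfty α) (hβ : IsClassKInfty β) : IsClassKInfty (α ∘ β) :=
  .of_surjective (hα.strictMono.comp hβ.strictMono) (hα.surjective.comp hβ.surjective)

theorem iterate (hα : IsClassKInfty α) (k : ℕ) : IsClassKInfty α^[k] :=
  .of_surjective (hα.strictMono.iterate k) (hα.surjective.iterate k)

theorem max (hα : IsClassKInfty α) (hβ : IsClassKInfty β) :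
    IsClassKInfty (fun r => max (α r) (β r)) where
  strictMono := fun _ _ h => max_lt_max (hα.strictMono h) (hβ.strictMono h)
  continuous := hα.continuous.max hβ.continuous
  map_zero := by simp [hα.map_zero, hβ.map_zero]
  unbounded := fun ⟨c, hc⟩ => hα.unbounded
    ⟨c, forall_mem_range.2 fun r => (le_max_left _ _).trans (hc (mem_range_self r))⟩

theorem exists_gain (hα : IsClassKInfty α) (hβ : IsClassKInfty β) :
    ∃ ρ, IsClassKInfty ρ ∧ (∀ r, r ≤ ρ r) ∧ ∀ a b, α a ≤ β b → a ≤ ρ b := by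
  let e := hα.strictMono.orderIsoOfSurjective α hα.surjective
  have he : IsClassKInfty e.symm := .of_surjective e.symm.strictMono e.symm.surjective
  refine ⟨_, he.comp (hα.max hβ), fun r => ?_, fun a b hab => ?_⟩
  · exact e.le_symm_apply.2 (le_max_left _ _)
  · exact e.le_symm_apply.2 (hab.trans (le_max_right _ _))

end IsClassKInfty

/-- The average of `φ` over `[r, 2r]`, computed after rescaling to `[1, 2]` so that it makes sense
at `r = 0`. For monotone `φ` it lies between `φ r` and `φ (2 * r)` and depends continuously on
`r` where `φ` need not. -/
noncomputable def dilationAverage (φ : ℝ≥0 → ℝ≥0) (r : ℝ≥0) : ℝ≥0 :=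
  (∫ u in (1 : ℝ)..2, (φ (r * u.toNNReal) : ℝ)).toNNReal

section dilationAverage

variable {φ ψ : ℝ≥0 → ℝ≥0} {r r' : ℝ≥0}

theorem monotone_dilation (hφ : Monotone φ) (r : ℝ≥0) :
    Monotone fun u : ℝ => (φ (r * u.toNNReal) : ℝ) :=
  fun _ _ huv => hφ (mul_le_mul_right (Real.toNNReal_le_toNNReal huv) r)

theorem dilationAverage_le_dilationAverage (hφ : Monotone φ) (hψ : Monotone ψ)
    (h : ∀ u : ℝ≥0, φ (r * u) ≤ ψ (r' * u)) : dilationAverage φ r ≤ dilationAverage ψ r' :=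
  Real.toNNReal_le_toNNReal <| intervalIntegral.integral_mono one_le_two
    (monotone_dilation hφ r).intervalIntegrable (monotone_dilation hψ r').intervalIntegrable
    fun u => h u.toNNReal

theorem monotone_dilationAverage (hφ : Monotone φ) : Monotone (dilationAverage φ) :=
  fun _ _ h => dilationAverage_le_dilationAverage hφ hφ fun u => hφ (mul_le_mul_left h u)

theorem le_dilationAverage (hφ : Monotone φ) (r : ℝ≥0) : φ r ≤ dilationAverage φ r := by
  calc φ r = (∫ _ in (1 : ℝ)..2, (φ r : ℝ)).toNNReal := by norm_num
    _ ≤ dilationAverage φ r := Real.toNNReal_le_toNNReal <|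
      intervalIntegral.integral_mono_on one_le_two (by simp)
        (monotone_dilation hφ r).intervalIntegrable fun u hu =>
          hφ (le_mul_of_one_le_right' (Real.one_le_toNNReal.2 hu.1))

theorem dilationAverage_le (hφ : Monotone φ) (r : ℝ≥0) :
    dilationAverage φ r ≤ φ (r * 2) := by
  calc dilationAverage φ r ≤ (∫ _ in (1 : ℝ)..2, (φ (r * 2) : ℝ)).toNNReal :=
      Real.toNNReal_le_toNNReal <| intervalIntegral.integral_mono_on one_le_two
        (monotone_dilation hφ r).intervalIntegrable (by simp) fun u hu =>
          hφ (mul_le_mul_right (Real.toNNReal_le_iff_le_coe.2 hu.2) r)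
    _ = φ (r * 2) := by norm_num

theorem continuous_dilationAverage (hφ : Monotone φ) (h0 : Tendsto φ (𝓝 0) (𝓝 0)) :
    Continuous (dilationAverage φ) := by
  refine continuous_iff_continuousAt.2 fun r => ?_
  rcases eq_zero_or_pos r with rfl | hr
  · have hdouble : Tendsto (fun r : ℝ≥0 => φ (r * 2)) (𝓝 0) (𝓝 0) :=
      h0.comp ((continuous_mul_const 2).tendsto' _ _ (zero_mul 2))
    have hzero : dilationAverage φ 0 = 0 := le_zero_iff.1 <|
      (dilationAverage_le hφ 0).trans_eq (by rw [zero_mul, eq_of_tendsto_nhds h0])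
    rw [ContinuousAt, hzero]
    exact tendsto_of_tendsto_of_tendsto_of_le_of_le tendsto_const_nhds hdouble
      (fun _ => zero_le) (dilationAverage_le hφ)
  · have hint : ∀ a b, IntervalIntegrable (fun u : ℝ => (φ u.toNNReal : ℝ))
        MeasureTheory.volume a b := fun a b =>
      Monotone.intervalIntegrable fun u v huv => hφ (Real.toNNReal_le_toNNReal huv)
    have hprim : Continuous fun b : ℝ => ∫ u in (0 : ℝ)..b, (φ u.toNNReal : ℝ) :=
      intervalIntegral.continuous_primitive hint 0
    have hquot : ∀ᶠ s : ℝ≥0 in 𝓝 r, dilationAverage φ s = ((s : ℝ)⁻¹ *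
        ((∫ u in (0 : ℝ)..(s * 2), (φ u.toNNReal : ℝ)) -
          ∫ u in (0 : ℝ)..s, (φ u.toNNReal : ℝ))).toNNReal := by
      filter_upwards [lt_mem_nhds hr] with s hs
      have hmul : ∀ u : ℝ, s * u.toNNReal = (s * u : ℝ).toNNReal := fun u => by
        rw [Real.toNNReal_mul s.coe_nonneg, Real.toNNReal_coe]
      simp_rw [dilationAverage, hmul]
      rw [intervalIntegral.integral_comp_mul_left (fun u => (φ u.toNNReal : ℝ))
        (NNReal.coe_ne_zero.2 hs.ne'), intervalIntegral.integral_interval_sub_left (hint _ _)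
        (hint _ _), mul_one, smul_eq_mul]
    refine ContinuousAt.congr_of_eventuallyEq ?_ hquot
    refine continuous_real_toNNReal.continuousAt.comp (.mul ?_ ?_)
    · exact NNReal.continuous_coe.continuousAt.inv₀ (NNReal.coe_ne_zero.2 hr.ne')
    · exact ((hprim.comp (NNReal.continuous_coe.mul continuous_const)).sub
        (hprim.comp NNReal.continuous_coe)).continuousAt

end dilationAverage

theorem IsClassKInfty.of_monotone_add_mul {φ : ℝ≥0 → ℝ≥0} (hmono : Monotone φ)
    (hcont : Continuous φ) (h0 : φ 0 = 0) {c : ℝ≥0} (hc : 0 < c) :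
    IsClassKInfty fun r => φ r + r * c where
  strictMono := hmono.add_strictMono fun _ _ h => mul_lt_mul_of_pos_right h hc
  continuous := hcont.add (continuous_mul_const c)
  map_zero := by simp [h0]
  unbounded := by
    rintro ⟨b, hb⟩
    have hle : b + 1 ≤ b := calc
      b + 1 = (b + 1) / c * c := (div_mul_cancel₀ _ hc.ne').symm
      _ ≤ φ ((b + 1) / c) + (b + 1) / c * c := le_add_of_nonneg_left zero_le
      _ ≤ b := hb (mem_range_self _)
    exact hle.not_gt (lt_add_one b)

theorem exists_isClassKL_ge {α : ℝ≥0 → ℝ≥0} (hα : IsClassKInfty α) {φ : ℝ≥0 → ℝ≥0 → ℝ≥0}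
    (hmono : ∀ s, Monotone fun r => φ r s) (hanti : ∀ r, Antitone (φ r))
    (hle : ∀ r s, φ r s ≤ α r) (hlim : ∀ r, Tendsto (φ r) atTop (𝓝 0)) :
    ∃ β, IsClassKL β ∧ ∀ r s, φ r s ≤ β r s := by
  have hα0 : Tendsto α (𝓝 0) (𝓝 0) := hα.continuous.tendsto' _ _ hα.map_zero
  have hφ0 : ∀ s, Tendsto (fun r => φ r s) (𝓝 0) (𝓝 0) := fun s =>
    tendsto_of_tendsto_of_tendsto_of_le_of_le tendsto_const_nhds hα0 (fun _ => zero_le)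
      fun r => hle r s
  refine ⟨fun r s => dilationAverage (fun r => φ r s) r + r * (1 + s)⁻¹,
    ⟨fun s => ?_, fun r => ?_, fun r => ?_⟩, fun r s => ?_⟩
  · refine .of_monotone_add_mul (monotone_dilationAverage (hmono s))
      (continuous_dilationAverage (hmono s) (hφ0 s)) ?_ (by positivity)
    simpa [hα.map_zero] using (dilationAverage_le (hmono s) 0).trans (hle (0 * 2) s)
  · intro s s' hs
    have := dilationAverage_le_dilationAverage (r := r) (hmono s') (hmono s)
      fun u => hanti (r * u) hs
    dsimp only
    gcongr
  · have hinv : Tendsto (fun s : ℝ≥0 => (1 + s)⁻¹) atTop (𝓝 0) := by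
      rw [← NNReal.tendsto_coe]
      push_cast
      exact tendsto_inv_atTop_zero.comp
        (tendsto_atTop_add_const_left _ _ (NNReal.tendsto_coe_atTop.2 tendsto_id))
    have havg : Tendsto (fun s => dilationAverage (fun r => φ r s) r) atTop (𝓝 0) :=
      tendsto_of_tendsto_of_tendsto_of_le_of_le tendsto_const_nhds (hlim (r * 2))
        (fun _ => zero_le) fun s => dilationAverage_le (hmono s) r
    simpa using havg.add (hinv.const_mul r)
  · exact (le_dilationAverage (hmono s) r).trans (le_add_of_nonneg_right zero_le)

/-! ### Switching signals -/

section Signals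

variable {m : ℕ} {σ : ℝ → Fin m} {s t : ℝ}

theorem nonneg_of_mem_switchingTimes (ht : t ∈ switchingTimes σ) : 0 ≤ t :=
  ht.elim Eq.ge fun h => h.1.le

theorem pos_of_notMem_switchingTimes (h : t ∉ switchingTimes σ) (ht : 0 ≤ t) : 0 < t :=
  ht.lt_of_ne fun h0 => h (Or.inl h0.symm)

theorem eventually_eq_of_notMem_switchingTimes (h : t ∉ switchingTimes σ) (ht : 0 ≤ t) :
    ∀ᶠ s in 𝓝 t, σ s = σ t := by
  have hcont : ContinuousAt σ t := by
    by_contra hdisc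
    exact h (Or.inr ⟨pos_of_notMem_switchingTimes h ht, hdisc⟩)
  rwa [ContinuousAt, nhds_discrete (Fin m), tendsto_pure] at hcont

theorem notMem_switchingTimes_of_eventually_eq {γ : Fin m} (ht : 0 < t)
    (h : ∀ᶠ s in 𝓝 t, σ s = γ) : t ∉ switchingTimes σ := by
  rintro (rfl | ⟨-, hdisc⟩)
  · exact ht.false
  · exact hdisc (tendsto_nhds_of_eventually_eq (h.self_of_nhds.symm ▸ h))

theorem eventually_notMem_of_finite_inter_Iic {S : Set ℝ} (hS : ∀ b, (S ∩ Iic b).Finite)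
    (t : ℝ) : ∀ᶠ s in 𝓝[≠] t, s ∉ S := by
  have hfar : ((S ∩ Iic (t + 1)) \ {t})ᶜ ∈ 𝓝 t :=
    (hS (t + 1)).sdiff.isClosed.isOpen_compl.mem_nhds (by simp)
  filter_upwards [mem_nhdsWithin_of_mem_nhds hfar, self_mem_nhdsWithin,
    mem_nhdsWithin_of_mem_nhds (Iic_mem_nhds (lt_add_one t))] with s hs hst hs1 hsS
  exact hs ⟨⟨hsS, hs1⟩, hst⟩

namespace IsSwitchingSignal

variable (hσ : IsSwitchingSignal σ)
include hσ

theorem eventually_eq_right (ht : 0 ≤ t) : ∀ᶠ s in 𝓝[≥] t, σ s = σ t := by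
  simpa [ContinuousWithinAt] using hσ.right_continuous t ht

theorem finite_switchingTimes (b : ℝ) : (switchingTimes σ ∩ Iic b).Finite :=
  ((hσ.locally_finite b).insert 0).subset fun _ hx => hx.1.imp id fun h => ⟨h, hx.2⟩

theorem eventually_notMem_switchingTimes (t : ℝ) : ∀ᶠ s in 𝓝[≠] t, s ∉ switchingTimes σ :=
  eventually_notMem_of_finite_inter_Iic hσ.finite_switchingTimes t

theorem eq_of_forall_notMem_switchingTimes (hs : 0 ≤ s) (hst : s ≤ t)
    (h : ∀ u ∈ Ioc s t, u ∉ switchingTimes σ) : σ t = σ s := by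
  refine isPreconnected_Icc.constant (s := Icc s t) (fun u hu => ?_) (right_mem_Icc.2 hst)
    (left_mem_Icc.2 hst)
  rcases hu.1.eq_or_lt with rfl | hsu
  · exact (hσ.right_continuous _ hs).mono Icc_subset_Ici_self
  · refine ContinuousAt.continuousWithinAt (tendsto_nhds_of_eventually_eq ?_)
    exact eventually_eq_of_notMem_switchingTimes (h u ⟨hsu, hu.2⟩) (hs.trans hu.1)

theorem exists_last_switchingTime (ht : 0 ≤ t) : ∃ s ∈ switchingTimes σ, s ≤ t ∧
    (∀ u ∈ Ioc s t, u ∉ switchingTimes σ) ∧ ∀ u ∈ Icc s t, σ u = σ t := by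
  obtain ⟨hmem, hub⟩ :=
    (hσ.finite_switchingTimes t).isCompact.isGreatest_sSup ⟨0, mem_insert _ _, ht⟩
  have hlast : ∀ u ∈ Ioc _ t, u ∉ switchingTimes σ := fun u hu hsw =>
    hu.1.not_ge (hub ⟨hsw, hu.2⟩)
  refine ⟨_, hmem.1, hmem.2, hlast, fun u hu => ?_⟩
  have hu0 : 0 ≤ u := (nonneg_of_mem_switchingTimes hmem.1).trans hu.1
  exact (hσ.eq_of_forall_notMem_switchingTimes hu0 hu.2 fun v hv =>
    hlast v ⟨hu.1.trans_lt hv.1, hv.2⟩).symm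

theorem exists_next_switchingTime (ht : t ∈ switchingTimes σ) (hst : s < t) :
    ∃ u ≤ t, IsLeast {u | u ∈ switchingTimes σ ∧ s < u} u := by
  have hfin : (switchingTimes σ ∩ Iic t ∩ Ioi s).Finite :=
    (hσ.finite_switchingTimes t).inter_of_left _
  obtain ⟨⟨⟨hmem, hle⟩, hlt⟩, hlb⟩ := hfin.isCompact.isLeast_sInf ⟨t, ⟨ht, self_mem_Iic⟩, hst⟩
  refine ⟨_, hle, ⟨hmem, hlt⟩, fun v hv => ?_⟩
  rcases le_total v t with hvt | htv
  · exact hlb ⟨⟨hv.1, hvt⟩, hv.2⟩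
  · exact (show _ ≤ t from hle).trans htv

theorem eq_of_mem_Ico_of_isLeast {u v : ℝ} (hs : 0 ≤ s)
    (hu : IsLeast {u | u ∈ switchingTimes σ ∧ s < u} u) (hv : v ∈ Ico s u) : σ v = σ s :=
  hσ.eq_of_forall_notMem_switchingTimes hs hv.1 fun _ hw hsw =>
    (hu.2 ⟨hsw, hw.1⟩).not_gt (hw.2.trans_lt hv.2)

end IsSwitchingSignal

end Signals

/-! ### Derivatives at exceptional times -/

section Derivatives

variable {E : Type*} [NormedAddCommGroup E] [NormedSpace ℝ E] {x g : ℝ → E} {t : ℝ} {e : E}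

theorem hasDerivWithinAt_Ici_of_eventually_hasDerivAt (hx : ContinuousWithinAt x (Ici t) t)
    (hg : Tendsto g (𝓝[>] t) (𝓝 e)) (hderiv : ∀ᶠ s in 𝓝[>] t, HasDerivAt x (g s) s) :
    HasDerivWithinAt x e (Ici t) t := by
  refine hasDerivWithinAt_Ici_of_tendsto_deriv
    (s := {s | s ∈ Ici t ∧ HasDerivAt x (g s) s})
    (fun s hs => hs.2.differentiableAt.differentiableWithinAt) (hx.mono fun s hs => hs.1) ?_
    (hg.congr' (hderiv.mono fun s hs => hs.deriv.symm))
  filter_upwards [self_mem_nhdsWithin, hderiv] with s hs hs' using ⟨Ioi_subset_Ici_self hs, hs'⟩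

theorem hasDerivWithinAt_Iic_of_eventually_hasDerivAt (hx : ContinuousWithinAt x (Iic t) t)
    (hg : Tendsto g (𝓝[<] t) (𝓝 e)) (hderiv : ∀ᶠ s in 𝓝[<] t, HasDerivAt x (g s) s) :
    HasDerivWithinAt x e (Iic t) t := by
  refine hasDerivWithinAt_Iic_of_tendsto_deriv
    (s := {s | s ∈ Iic t ∧ HasDerivAt x (g s) s})
    (fun s hs => hs.2.differentiableAt.differentiableWithinAt) (hx.mono fun s hs => hs.1) ?_
    (hg.congr' (hderiv.mono fun s hs => hs.deriv.symm))
  filter_upwards [self_mem_nhdsWithin, hderiv] with s hs hs' using ⟨Iio_subset_Iic_self hs, hs'⟩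

theorem hasDerivAt_of_eventually_hasDerivAt_punctured (hx : ContinuousAt x t)
    (hg : Tendsto g (𝓝[≠] t) (𝓝 e)) (hderiv : ∀ᶠ s in 𝓝[≠] t, HasDerivAt x (g s) s) :
    HasDerivAt x e t := by
  have hlt : 𝓝[<] t ≤ 𝓝[≠] t := nhdsWithin_mono t fun s hs => ne_of_lt hs
  have hgt : 𝓝[>] t ≤ 𝓝[≠] t := nhdsWithin_mono t fun s hs => ne_of_gt hs
  rw [← hasDerivWithinAt_univ, ← Iic_union_Ici (a := t)]
  exact (hasDerivWithinAt_Iic_of_eventually_hasDerivAt hx.continuousWithinAt (hg.mono_left hlt)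
    (hlt hderiv)).union (hasDerivWithinAt_Ici_of_eventually_hasDerivAt hx.continuousWithinAt
      (hg.mono_left hgt) (hgt hderiv))

end Derivatives

/-! ### Solutions -/

theorem exists_nnnorm_le_of_norm_le {ι E E' : Type*} [Finite ι] [NormedAddCommGroup E]
    [ProperSpace E] [NormedAddCommGroup E'] {f : ι → E → E'} (hf : ∀ i, Continuous (f i))
    (R : ℝ) : ∃ C : ℝ≥0, ∀ i ξ, ‖ξ‖ ≤ R → ‖f i ξ‖₊ ≤ C := by
  cases nonempty_fintype ι
  obtain ⟨C, hC⟩ := (isCompact_closedBall (0 : E) R).exists_bound_of_continuousOn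
    (continuous_pi hf).continuousOn
  refine ⟨C.toNNReal, fun i ξ hξ => NNReal.le_toNNReal_of_coe_le ?_⟩
  exact (norm_le_pi_norm (fun j => f j ξ) i).trans (hC ξ (mem_closedBall_zero_iff.2 hξ))

variable {n m : ℕ} {f : Fin m → EuclideanSpace ℝ (Fin n) → EuclideanSpace ℝ (Fin n)}
  {χ : Fin m → Set (EuclideanSpace ℝ (Fin n))} {V : EuclideanSpace ℝ (Fin n) → Fin m → ℝ}
  {σ : ℝ → Fin m} {p : Traj n m}

namespace IsSolution

variable {I : Set ℝ} {x y : ℝ → EuclideanSpace ℝ (Fin n)} {t T R : ℝ}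

theorem congr (hx : IsSolution f σ I x) (hxy : EqOn x y I) : IsSolution f σ I y where
  continuousOn := hx.continuousOn.congr hxy.symm
  hasDeriv t ht hts := hxy ht ▸ (hx.hasDeriv t ht hts).congr_of_mem hxy.symm ht

theorem hasDerivAt (hx : IsSolution f σ I x) (hI : I ∈ 𝓝 t) (ht : t ∉ switchingTimes σ) :
    HasDerivAt x (f (σ t) (x t)) t :=
  (hx.hasDeriv t (mem_of_mem_nhds hI) ht).hasDerivAt hI

theorem hasDerivWithinAt_Ici (hf : ∀ γ, Continuous (f γ)) (hσ : IsSwitchingSignal σ)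
    (hx : IsSolution f σ I x) (ht : 0 ≤ t) (hI : I ∈ 𝓝[≥] t) :
    HasDerivWithinAt x (f (σ t) (x t)) (Ici t) t := by
  have hc : ContinuousWithinAt x (Ici t) t :=
    (hx.continuousOn t (mem_of_mem_nhdsWithin self_mem_Ici hI)).mono_of_mem_nhdsWithin hI
  obtain ⟨b, hb, hbI⟩ := mem_nhdsGE_iff_exists_Ico_subset.1 hI
  refine hasDerivWithinAt_Ici_of_eventually_hasDerivAt hc
    (((hf _).tendsto _).comp (hc.mono Ioi_subset_Ici_self)) ?_
  filter_upwards [Ioo_mem_nhdsGT hb,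
    nhdsWithin_mono t (fun u hu => ne_of_gt hu) (hσ.eventually_notMem_switchingTimes t),
    nhdsWithin_mono t Ioi_subset_Ici_self (hσ.eventually_eq_right ht)] with u hu hus hσu
  rw [Function.comp_apply, ← hσu]
  exact hx.hasDerivAt (mem_of_superset (Ioo_mem_nhds hu.1 hu.2)
    (Ioo_subset_Ico_self.trans hbI)) hus

theorem lipschitzOnWith (hf : ∀ γ, Continuous (f γ)) (hσ : IsSwitchingSignal σ)
    (hx : IsSolution f σ I x) (hI : I.OrdConnected) (hI0 : I ⊆ Ici 0) {C : ℝ≥0}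
    (hC : ∀ t ∈ I, ‖f (σ t) (x t)‖₊ ≤ C) : LipschitzOnWith C x I := by
  have hle : ∀ s ∈ I, ∀ t ∈ I, s ≤ t → ‖x t - x s‖ ≤ C * (t - s) := fun s hs t ht hst =>
    have hsub := hI.out hs ht
    norm_image_sub_le_of_norm_deriv_right_le_segment (hx.continuousOn.mono hsub)
      (fun u hu => hx.hasDerivWithinAt_Ici hf hσ (hI0 (hsub (Ico_subset_Icc_self hu)))
        (mem_of_superset (Icc_mem_nhdsGE_of_mem hu) hsub))
      (fun u hu => hC u (hsub (Ico_subset_Icc_self hu))) t (right_mem_Icc.2 hst)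
  refine LipschitzOnWith.of_dist_le_mul fun s hs t ht => ?_
  rcases le_total s t with hst | hts
  · rw [dist_comm, dist_comm s, dist_eq_norm, Real.dist_eq, abs_of_nonneg (sub_nonneg.2 hst)]
    exact hle s hs t ht hst
  · rw [dist_eq_norm, Real.dist_eq, abs_of_nonneg (sub_nonneg.2 hts)]
    exact hle t ht s hs hts

theorem exists_extension_Icc (hf : ∀ γ, Continuous (f γ)) (hσ : IsSwitchingSignal σ)
    (hx : IsSolution f σ (Ico 0 T) x) (hT : 0 < T) (hR : ∀ t ∈ Ico 0 T, ‖x t‖ ≤ R) :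
    ∃ y, IsSolution f σ (Icc 0 T) y ∧ EqOn x y (Ico 0 T) := by
  obtain ⟨C, hC⟩ := exists_nnnorm_le_of_norm_le hf R
  obtain ⟨y, hy, hxy⟩ := (hx.lipschitzOnWith hf hσ ordConnected_Ico (fun t ht => ht.1)
    fun t ht => hC (σ t) _ (hR t ht)).extend_finite_dimension
  have hyc := hy.continuous
  have hderiv : ∀ t ∈ Ioo 0 T, t ∉ switchingTimes σ → HasDerivAt y (f (σ t) (y t)) t :=
    fun t ht hts => (hx.congr hxy).hasDerivAt (Ico_mem_nhds ht.1 ht.2) hts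
  refine ⟨y, ⟨hyc.continuousOn, fun t ht hts => ?_⟩, hxy⟩
  have ht0 := pos_of_notMem_switchingTimes hts ht.1
  rcases ht.2.eq_or_lt with rfl | htT
  · refine (hasDerivWithinAt_Iic_of_eventually_hasDerivAt hyc.continuousWithinAt
      (((hf (σ t)).comp hyc).continuousWithinAt) ?_).mono Icc_subset_Iic_self
    filter_upwards [Ioo_mem_nhdsLT ht0,
      nhdsWithin_mono t (fun u hu => ne_of_lt hu) (hσ.eventually_notMem_switchingTimes t),
      mem_nhdsWithin_of_mem_nhds (eventually_eq_of_notMem_switchingTimes hts ht.1)]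
      with u hu hus hσu
    exact hσu ▸ hderiv u hu hus
  · exact (hderiv t ⟨ht0, htT⟩ hts).hasDerivWithinAt

end IsSolution

/-! ### Domains of trajectories -/

namespace Traj

theorem ordConnected_dom : p.dom.OrdConnected :=
  ⟨fun _ ha _ hb _ hu => ⟨ha.1.trans hu.1, (EReal.coe_le_coe_iff.2 hu.2).trans_lt hb.2⟩⟩

theorem dom_eq_Ici (h : p.T = ⊤) : p.dom = Ici 0 := by
  ext t
  simp [dom, h]

theorem zero_mem_dom (h : 0 < p.T) : (0 : ℝ) ∈ p.dom := ⟨le_rfl, h⟩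

theorem IsMaximal.T_eq_top (hf : ∀ γ, Continuous (f γ)) (hp : p.IsMaximal f) {R : ℝ}
    (hR : ∀ t ∈ p.dom, ‖p.x t‖ ≤ R) : p.T = ⊤ := by
  by_contra hT
  obtain ⟨T, hTp⟩ : ∃ T : ℝ, p.T = T :=
    ⟨p.T.toReal, (EReal.coe_toReal hT (bot_le.trans_lt hp.pos).ne').symm⟩
  have hT0 : 0 < T := by simpa [hTp] using hp.pos
  have hdom : p.dom = Ico 0 T := by
    ext t
    simp [dom, hTp]
  obtain ⟨y, hy, hxy⟩ := (hdom ▸ hp.isSolution).exists_extension_Icc hf hp.isSwitchingSignal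
    hT0 (hdom ▸ hR)
  have hTdom : T ∈ p.dom := hp.not_extendable (Icc 0 T) y (Or.inl ⟨T, hT0, Or.inr rfl⟩) hy
    (hdom ▸ Ico_subset_Icc_self) (hdom ▸ hxy) (right_mem_Icc.2 hT0.le)
  exact right_notMem_Ico (hdom ▸ hTdom)

theorem isMaximal_of_T_eq_top (hT : p.T = ⊤) (hσ : IsSwitchingSignal p.σ)
    (hx : IsSolution f p.σ (Ici 0) p.x) : p.IsMaximal f where
  isSwitchingSignal := hσ
  pos := hT ▸ EReal.zero_lt_top
  isSolution := dom_eq_Ici hT ▸ hx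
  not_extendable := by
    intro J y hJ _ _ _
    rw [dom_eq_Ici hT]
    rcases hJ with ⟨T, -, rfl | rfl⟩ | rfl
    · exact Ico_subset_Icc_self.trans Icc_subset_Ici_self
    · exact Icc_subset_Ici_self
    · exact Subset.rfl

end Traj

/-! ### Lyapunov-like functions along trajectories -/

theorem antitoneOn_comp_of_fderiv_nonpos {E : Type*} [NormedAddCommGroup E] [NormedSpace ℝ E]
    {W : E → ℝ} {x v : ℝ → E} {D : Set ℝ} (hD : Convex ℝ D) (hW : Differentiable ℝ W)
    (hx : ContinuousOn x D) (hv : ∀ u ∈ interior D, HasDerivAt x (v u) u)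
    (hWv : ∀ u ∈ interior D, fderiv ℝ W (x u) (v u) ≤ 0) : AntitoneOn (W ∘ x) D :=
  antitoneOn_of_hasDerivWithinAt_nonpos hD (hW.continuous.comp_continuousOn hx)
    (fun u hu => ((hW (x u)).hasFDerivAt.comp_hasDerivAt u (hv u hu)).hasDerivWithinAt) hWv

namespace IsWeakLyapunovLike

variable {F : Set (Traj n m)} (hV : IsWeakLyapunovLike f χ F V)
include hV

theorem antitoneOn_of_eqOn_Ico (hp : p ∈ coveredTrajs f χ) {a b : ℝ} {γ : Fin m} (ha : 0 ≤ a)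
    (hb : b ∈ p.dom) (hγ : ∀ u ∈ Ico a b, p.σ u = γ) :
    AntitoneOn (fun u => V (p.x u) γ) (Icc a b) := by
  intro s hs t ht hst
  have hab : a ≤ b := hs.1.trans hs.2
  have ha_dom : a ∈ p.dom := ⟨ha, (EReal.coe_le_coe_iff.2 hab).trans_lt hb.2⟩
  have hsub : Icc a b ⊆ p.dom := Traj.ordConnected_dom.out ha_dom hb
  have hγ' : ∀ u ∈ interior (Icc a b), u ∈ Ioo a b ∧ p.σ u = γ := fun u hu => by
    rw [interior_Icc] at hu
    exact ⟨hu, hγ u (Ioo_subset_Ico_self hu)⟩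
  refine antitoneOn_comp_of_fderiv_nonpos (v := fun u => f γ (p.x u)) (convex_Icc a b)
    ((hV.contDiff γ).differentiable one_ne_zero) (hp.1.isSolution.continuousOn.mono hsub)
    (fun u hu => ?_) (fun u hu => hV.deriv_nonpos γ _ ?_) hs ht hst
  · rw [← (hγ' u hu).2]
    refine hp.1.isSolution.hasDerivAt (mem_of_superset (mem_interior_iff_mem_nhds.1 hu) hsub) ?_
    have hu' := (hγ' u hu).1
    refine notMem_switchingTimes_of_eventually_eq (γ := γ) (ha.trans_lt hu'.1) ?_
    exact mem_of_superset (Ioo_mem_nhds hu'.1 hu'.2) fun v hv => hγ v (Ioo_subset_Ico_self hv)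
  · rw [← (hγ' u hu).2]
    exact hp.2 u (hsub (interior_subset hu))

theorem subset_nonincreasingTrajs (hFχ : F ⊆ coveredTrajs f χ) : F ⊆ nonincreasingTrajs f V := by
  intro p hp
  have hσ := (hFχ hp).1.isSwitchingSignal
  refine ⟨(hFχ hp).1, fun t ht t' ht' htt' hmode => ?_⟩
  obtain ⟨s, hs, hst, hlast, hconst⟩ := hσ.exists_last_switchingTime ht.1
  obtain ⟨s', hs', hst', -, hconst'⟩ := hσ.exists_last_switchingTime ht'.1
  rcases le_or_gt s' t with hst | hts'
  · refine hmode ▸ hV.antitoneOn_of_eqOn_Ico (hFχ hp) ht.1 ht' (fun u hu => ?_)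
      (left_mem_Icc.2 htt') (right_mem_Icc.2 htt') htt'
    rw [hconst' u ⟨hst.trans hu.1, hu.2.le⟩, hmode]
  obtain ⟨u, hus', hu⟩ := hσ.exists_next_switchingTime hs' (hst.trans_lt hts')
  have hs0 := nonneg_of_mem_switchingTimes hs
  have hs'0 := nonneg_of_mem_switchingTimes hs'
  have hs'_dom : s' ∈ p.dom := ⟨hs'0, (EReal.coe_le_coe_iff.2 hst').trans_lt ht'.2⟩
  have hu_dom : u ∈ p.dom := ⟨hs0.trans hu.1.2.le, (EReal.coe_le_coe_iff.2 hus').trans_lt hs'_dom.2⟩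
  have htu : t < u := not_le.1 fun hut => hlast u ⟨hu.1.2, hut⟩ hu.1.1
  have hσs : p.σ s = p.σ t := hconst s (left_mem_Icc.2 hst)
  have hσs' : p.σ s' = p.σ t' := hconst' s' (left_mem_Icc.2 hst')
  calc V (p.x t') (p.σ t') = V (p.x t') (p.σ s') := by rw [hσs']
    _ ≤ V (p.x s') (p.σ s') :=
      hV.antitoneOn_of_eqOn_Ico (hFχ hp) hs'0 ht'
        (fun v hv => (hconst' v (Ico_subset_Icc_self hv)).trans hσs'.symm)
        (left_mem_Icc.2 hst') (right_mem_Icc.2 hst') hst'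
    _ ≤ V (p.x u) (p.σ s) :=
      hV.switch p hp s hs s' hs' hs'_dom (hst.trans_lt hts') (by rw [hσs, hσs', hmode]) u hu
    _ ≤ V (p.x t) (p.σ s) :=
      hV.antitoneOn_of_eqOn_Ico (hFχ hp) hs0 hu_dom
        (fun v hv => hσ.eq_of_mem_Ico_of_isLeast hs0 hu hv)
        ⟨hst, htu.le⟩ (right_mem_Icc.2 hu.1.2.le) htu.le
    _ = V (p.x t) (p.σ t) := by rw [hσs]

end IsWeakLyapunovLike

/-! ### Stability -/

section Modes

variable {Γ β : Type*} [TopologicalSpace β] [Preorder β] [OrderClosedTopology β]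
  {σ : ℝ → Γ} {r : ℝ → β} {a b : ℝ}

theorem exists_last_visit {c : β} (hab : a ≤ b) (hr : ContinuousOn r (Icc a b))
    (hc : ∀ u ∈ Icc a b, σ u = σ a → r u ≤ c) :
    ∃ l ∈ Icc a b, r l ≤ c ∧ ∀ u ∈ Ioc l b, σ u ≠ σ a := by
  set S := {u ∈ Icc a b | σ u = σ a}
  have haS : a ∈ S := ⟨left_mem_Icc.2 hab, rfl⟩
  have hlub : IsLUB S (sSup S) := isLUB_csSup ⟨a, haS⟩ ⟨b, fun u hu => hu.1.2⟩
  have hl : sSup S ∈ Icc a b := ⟨hlub.1 haS, hlub.2 fun u hu => hu.1.2⟩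
  refine ⟨sSup S, hl, ?_, fun u hu hσu => ?_⟩
  · have : (𝓝[S] sSup S).NeBot :=
      mem_closure_iff_nhdsWithin_neBot.1 (hlub.mem_closure ⟨a, haS⟩)
    refine le_of_tendsto ((hr _ hl).mono fun u (hu : u ∈ S) => hu.1) ?_
    filter_upwards [self_mem_nhdsWithin] with u hu using hc u hu.1 hu.2
  · exact (hlub.1 ⟨⟨hl.1.trans hu.1.le, hu.2⟩, hσu⟩).not_gt hu.1

-- After its last visit to the initial mode, the path uses one mode less.
theorem le_iterate_card_of_forall_mem {ρ : β → β} (hρ : Continuous ρ) (hmono : Monotone ρ)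
    (hid : ∀ y, y ≤ ρ y) (G : Finset Γ) (hab : a ≤ b) (hr : ContinuousOn r (Icc a b))
    (hmode : ∀ s ∈ Icc a b, ∀ t ∈ Icc s b, σ s = σ t → r t ≤ ρ (r s))
    (hG : ∀ u ∈ Icc a b, σ u ∈ G) : r b ≤ ρ^[G.card] (r a) := by
  classical
  induction hk : G.card generalizing G a with
  | zero => simpa [Finset.card_eq_zero.1 hk] using hG a (left_mem_Icc.2 hab)
  | succ k ih =>
    have haG : σ a ∈ G := hG a (left_mem_Icc.2 hab)
    obtain ⟨l, hl, hrl, hlast⟩ := exists_last_visit hab hr fun u hu hσu =>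
      hmode a (left_mem_Icc.2 hab) u hu hσu.symm
    rw [Function.iterate_succ_apply]
    rcases hl.2.eq_or_lt with rfl | hlb
    · exact hrl.trans (Function.id_le_iterate_of_id_le hid k _)
    have hlim : Tendsto (fun u => ρ^[k] (r u)) (𝓝[>] l) (𝓝 (ρ^[k] (r l))) := by
      refine ((hρ.iterate k).tendsto _).comp ?_
      refine (hr l hl).mono_left (nhdsWithin_le_of_mem ?_)
      exact mem_of_superset (Ioo_mem_nhdsGT hlb) fun u hu => ⟨hl.1.trans hu.1.le, hu.2.le⟩
    refine (ge_of_tendsto hlim ?_).trans (hmono.iterate k hrl)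
    filter_upwards [Ioo_mem_nhdsGT hlb] with u hu
    have hsub : Icc u b ⊆ Icc a b := Icc_subset_Icc_left (hl.1.trans hu.1.le)
    refine ih (G.erase (σ a)) hu.2.le (hr.mono hsub) (fun s hs => hmode s (hsub hs))
      (fun v hv => ?_) ?_
    · exact Finset.mem_erase.2 ⟨hlast v ⟨hu.1.trans_le hv.1, hv.2⟩, hG v (hsub hv)⟩
    · rw [Finset.card_erase_of_mem haG, hk, Nat.add_sub_cancel]

end Modes

theorem nnnorm_le_iterate_of_mem_nonincreasing_covered {α₁ α₂ ρ : ℝ≥0 → ℝ≥0}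
    (hρ : IsClassKInfty ρ) (hid : ∀ r, r ≤ ρ r) (hgain : ∀ a b, α₁ a ≤ α₂ b → a ≤ ρ b)
    (hb : ∀ γ, ∀ ξ ∈ χ γ, (α₁ ‖ξ‖₊ : ℝ) ≤ V ξ γ ∧ V ξ γ ≤ (α₂ ‖ξ‖₊ : ℝ))
    (hp : p ∈ nonincreasingTrajs f V ∩ coveredTrajs f χ) {s t : ℝ} (hs : s ∈ p.dom)
    (ht : t ∈ p.dom) (hst : s ≤ t) : ‖p.x t‖₊ ≤ ρ^[m] ‖p.x s‖₊ := by
  have hsub : Icc s t ⊆ p.dom := Traj.ordConnected_dom.out hs ht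
  suffices h : ‖p.x t‖₊ ≤ ρ^[(Finset.univ : Finset (Fin m)).card] ‖p.x s‖₊ by
    rwa [Finset.card_fin] at h
  refine le_iterate_card_of_forall_mem (σ := p.σ) (r := fun u => ‖p.x u‖₊) hρ.continuous
    hρ.strictMono.monotone hid _ hst (hp.1.1.isSolution.continuousOn.mono hsub).nnnorm
    (fun u hu v hv hσ => hgain _ _ ?_) fun _ _ => Finset.mem_univ _
  have hu_dom := hsub hu
  have hv_dom := hsub ⟨hu.1.trans hv.1, hv.2⟩
  rw [← NNReal.coe_le_coe]
  exact (hb _ _ (hp.2.2 v hv_dom)).1.trans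
    ((hp.1.2 u hu_dom v hv_dom hv.1 hσ).trans (hb _ _ (hp.2.2 u hu_dom)).2)

theorem uniformlyStable_nonincreasing_inter_covered (hf : ∀ γ, Continuous (f γ))
    {α₁ α₂ : ℝ≥0 → ℝ≥0} (hα₁ : IsClassKInfty α₁) (hα₂ : IsClassKInfty α₂)
    (hb : ∀ γ, ∀ ξ ∈ χ γ, (α₁ ‖ξ‖₊ : ℝ) ≤ V ξ γ ∧ V ξ γ ≤ (α₂ ‖ξ‖₊ : ℝ)) :
    UniformlyStable (nonincreasingTrajs f V ∩ coveredTrajs f χ) := by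
  obtain ⟨ρ, hρ, hid, hgain⟩ := hα₁.exists_gain hα₂
  refine ⟨ρ^[m], hρ.iterate m, fun p hp => ?_⟩
  have hT : p.T = ⊤ := hp.1.1.T_eq_top hf (R := ρ^[m] ‖p.x 0‖₊) fun t ht =>
    nnnorm_le_iterate_of_mem_nonincreasing_covered hρ hid hgain hb hp
      (Traj.zero_mem_dom hp.1.1.pos) ht ht.1
  refine ⟨hT, fun t₀ t ht₀ ht => ?_⟩
  exact nnnorm_le_iterate_of_mem_nonincreasing_covered hρ hid hgain hb hp
    (Traj.dom_eq_Ici hT ▸ ht₀) (Traj.dom_eq_Ici hT ▸ ht₀.trans ht) ht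

theorem UniformlyStable.mono {F G : Set (Traj n m)} (hG : UniformlyStable G) (h : F ⊆ G) :
    UniformlyStable F :=
  let ⟨α, hα, hle⟩ := hG
  ⟨α, hα, fun p hp => hle p (h hp)⟩

/-! ### Limits of switching signals -/

section LimitSignals

variable {ι : Type*} {l : Filter ι} {U : Ultrafilter ι} {σs : ι → ℝ → Fin m} {τ : ℝ} {N : ℕ}

/-- Convergence of switching signals along `l`: except at isolated times, the signals `σs k` agree
for large `k` with `σ` in a fixed neighbourhood of the given positive time. -/
def SignalsConverge (l : Filter ι) (σs : ι → ℝ → Fin m) (σ : ℝ → Fin m) : Prop :=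
  ∀ t, 0 ≤ t → ∀ᶠ s in 𝓝[≠] t, 0 < s → ∀ᶠ q in l ×ˢ 𝓝 s, σs q.1 q.2 = σ s

theorem SignalsConverge.eventually_eq_right (h : SignalsConverge l σs σ)
    (hσ : IsSwitchingSignal σ) {t : ℝ} (ht : 0 ≤ t) :
    ∀ᶠ s in 𝓝[>] t, ∀ᶠ k in l, σs k s = σ t := by
  filter_upwards [nhdsWithin_mono t (fun u hu => ne_of_gt hu) (h t ht), self_mem_nhdsWithin,
    nhdsWithin_mono t Ioi_subset_Ici_self (hσ.eventually_eq_right ht)] with s hs hts hσs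
  exact hσs ▸ (hs (ht.trans_lt hts)).curry.mono fun k hk => hk.self_of_nhds

/-- The positive times at which switchings of the signals `σs k` accumulate along `l`. -/
def limitSwitchings (l : Filter ι) (σs : ι → ℝ → Fin m) : Set ℝ :=
  {t | 0 < t ∧ ∃ᶠ q in l ×ˢ 𝓝 t, q.2 ∈ discontinuities (σs q.1)}

theorem eventually_nonempty_discontinuities_inter {t : ℝ} (ht : t ∈ limitSwitchings U σs)
    {W : Set ℝ} (hW : W ∈ 𝓝 t) : ∀ᶠ k in U, (discontinuities (σs k) ∩ W).Nonempty := by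
  by_contra hev
  refine ht.2 ?_
  filter_upwards [prod_mem_prod (Ultrafilter.eventually_not.2 hev) hW] with q hq hdisc
  exact hq.1 ⟨q.2, hdisc, hq.2⟩

theorem card_le_of_subset_limitSwitchings (hσ : ∀ k, IsSwitchingSignal (σs k))
    (hN : ∀ k, HasAverageDwellTime τ N (σs k)) {a b : ℝ} (ha : 0 ≤ a) (hab : a < b)
    (S : Finset ℝ) (hS : (S : Set ℝ) ⊆ limitSwitchings U σs ∩ Ioo a b) :
    (S.card : ℝ) ≤ N + (b - a) / τ := by
  obtain ⟨W, hW, hdisj⟩ := S.finite_toSet.t2_separation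
  have hev : ∀ᶠ k in U, ∀ t ∈ S, (discontinuities (σs k) ∩ (W t ∩ Ioo a b)).Nonempty :=
    (Finset.eventually_all S).2 fun t ht => eventually_nonempty_discontinuities_inter (hS ht).1
      (inter_mem ((hW t).2.mem_nhds (hW t).1) (Ioo_mem_nhds (hS ht).2.1 (hS ht).2.2))
  obtain ⟨k, hk⟩ := hev.exists
  choose! g hg using hk
  have hinj : InjOn g S := by
    intro t ht t' ht' htt'
    by_contra hne
    exact disjoint_left.1 (hdisj ht ht' hne) (hg t ht).2.1 (htt' ▸ (hg t' ht').2.1)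
  have hfin : (discontinuities (σs k) ∩ Ioo a b).Finite :=
    ((hσ k).locally_finite b).subset fun _ h => ⟨h.1, h.2.2.le⟩
  calc (S.card : ℝ) = (S : Set ℝ).ncard := by rw [ncard_coe_finset]
    _ ≤ (discontinuities (σs k) ∩ Ioo a b).ncard := Nat.cast_le.2 <|
      ncard_le_ncard_of_injOn g (fun t ht => ⟨(hg t ht).1, (hg t ht).2.2⟩) hinj hfin
    _ ≤ N + (b - a) / τ := hN k a b ha hab

theorem finite_limitSwitchings_inter_Ioo (hσ : ∀ k, IsSwitchingSignal (σs k))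
    (hN : ∀ k, HasAverageDwellTime τ N (σs k)) {a b : ℝ} (ha : 0 ≤ a) (hab : a < b) :
    (limitSwitchings U σs ∩ Ioo a b).Finite := by
  by_contra hinf
  obtain ⟨M, hM⟩ := exists_nat_gt (N + (b - a) / τ)
  obtain ⟨S, hS, hcard⟩ := Set.Infinite.exists_subset_card_eq hinf M
  exact hM.not_ge (hcard ▸ card_le_of_subset_limitSwitchings hσ hN ha hab S hS)

theorem finite_limitSwitchings_inter_Iic (hσ : ∀ k, IsSwitchingSignal (σs k))
    (hN : ∀ k, HasAverageDwellTime τ N (σs k)) (b : ℝ) :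
    (limitSwitchings U σs ∩ Iic b).Finite :=
  (finite_limitSwitchings_inter_Ioo hσ hN le_rfl (by positivity : (0 : ℝ) < |b| + 1)).subset
    fun _ h => ⟨h.1, h.1.1, (h.2.trans (le_abs_self b)).trans_lt (lt_add_one _)⟩

theorem eventually_prod_eq_of_notMem_limitSwitchings {t : ℝ} (ht : 0 < t)
    (htU : t ∉ limitSwitchings l σs) {γ : Fin m} (hγ : ∀ᶠ k in l, σs k t = γ) :
    ∀ᶠ q in l ×ˢ 𝓝 t, σs q.1 q.2 = γ := by
  have hev : ∀ᶠ q in l ×ˢ 𝓝 t, q.2 ∉ discontinuities (σs q.1) :=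
    not_frequently.1 fun hfreq => htU ⟨ht, hfreq⟩
  obtain ⟨A, hA, W, hW, hAW⟩ := eventually_prod_iff.1 hev
  obtain ⟨ε, hε, hball⟩ := Metric.mem_nhds_iff.1 (inter_mem hW (Ioi_mem_nhds ht))
  refine eventually_prod_iff.2 ⟨_, hA.and hγ, _, Metric.ball_mem_nhds t hε, fun hk s hs => ?_⟩
  rw [← hk.2]
  refine (convex_ball t ε).isPreconnected.constant (fun u hu => ?_) hs (Metric.mem_ball_self hε)
  refine ContinuousAt.continuousWithinAt ?_
  by_contra hdisc
  exact hAW hk.1 (hball hu).1 ⟨(hball hu).2, hdisc⟩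

theorem exists_tendsto_nhdsGT_of_continuousAt {κ : ℝ → Fin m} {B : Set ℝ} {t : ℝ} (ht : 0 ≤ t)
    (hB : ∀ᶠ s in 𝓝[≠] t, s ∉ B) (hκ : ∀ t, 0 < t → t ∉ B → ContinuousAt κ t) :
    ∃ γ, Tendsto κ (𝓝[>] t) (𝓝 γ) := by
  obtain ⟨b, hb, hsub⟩ := mem_nhdsGT_iff_exists_Ioo_subset.1
    (nhdsWithin_mono t (fun u hu => ne_of_gt hu) hB)
  obtain ⟨c, hc⟩ := nonempty_Ioo.2 (mem_Ioi.1 hb)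
  refine ⟨κ c, tendsto_nhds_of_eventually_eq ?_⟩
  filter_upwards [Ioo_mem_nhdsGT hb] with s hs
  exact isPreconnected_Ioo.constant
    (fun u hu => (hκ u (ht.trans_lt hu.1) (hsub hu)).continuousWithinAt) hs hc

theorem exists_isSwitchingSignal_of_continuousAt {κ : ℝ → Fin m} {B : Set ℝ}
    (hB : ∀ b, (B ∩ Iic b).Finite) (hκ : ∀ t, 0 < t → t ∉ B → ContinuousAt κ t) :
    ∃ σ, IsSwitchingSignal σ ∧ discontinuities σ ⊆ B ∧ ∀ t, 0 < t → t ∉ B → σ t = κ t := by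
  have heq : ∀ t, 0 < t → t ∉ B → Function.rightLim κ t = κ t := fun t ht htB =>
    (hκ t ht htB).continuousWithinAt.rightLim_eq
  have hdisc : discontinuities (Function.rightLim κ) ⊆ B := by
    intro t ht
    by_contra htB
    refine ht.2 ((hκ t ht.1 htB).congr ?_)
    filter_upwards [lt_mem_nhds ht.1,
      eventually_nhdsWithin_iff.1 (eventually_notMem_of_finite_inter_Iic hB t)] with s hs hsB
    exact (heq s hs fun h => hsB (fun hst => htB (hst ▸ h)) h).symm
  refine ⟨Function.rightLim κ, ⟨fun t ht => ?_, fun b => ?_⟩, hdisc, heq⟩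
  · exact continuousWithinAt_rightLim_Ici <| tendsto_rightLim_of_tendsto <|
      exists_tendsto_nhdsGT_of_continuousAt ht (eventually_notMem_of_finite_inter_Iic hB t) hκ
  · exact (hB b).subset (inter_subset_inter_left _ hdisc)

theorem exists_signalsConverge (U : Ultrafilter ι) (hσ : ∀ k, IsSwitchingSignal (σs k))
    (hN : ∀ k, HasAverageDwellTime τ N (σs k)) :
    ∃ σ, IsSwitchingSignal σ ∧ HasAverageDwellTime τ N σ ∧ SignalsConverge U σs σ := by
  have hlim : ∀ t, ∃ γ, ∀ᶠ k in U, σs k t = γ := fun t =>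
    Ultrafilter.eventually_exists_iff.1 (.of_forall fun k => ⟨σs k t, rfl⟩)
  choose κ hκ using hlim
  have hconv : ∀ t, 0 < t → t ∉ limitSwitchings U σs → ∀ᶠ q in ↑U ×ˢ 𝓝 t, σs q.1 q.2 = κ t :=
    fun t ht htU => eventually_prod_eq_of_notMem_limitSwitchings ht htU (hκ t)
  have hcont : ∀ t, 0 < t → t ∉ limitSwitchings U σs → ContinuousAt κ t := by
    refine fun t ht htU => tendsto_nhds_of_eventually_eq ?_
    obtain ⟨A, hA, W, hW, hAW⟩ := eventually_prod_iff.1 (hconv t ht htU)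
    filter_upwards [hW] with s hs
    obtain ⟨k, hkA, hks⟩ := (hA.and (hκ s)).exists
    exact hks.symm.trans (hAW hkA hs)
  have hfin := finite_limitSwitchings_inter_Iic (U := U) hσ hN
  obtain ⟨σ, hσ', hdisc, hσκ⟩ := exists_isSwitchingSignal_of_continuousAt hfin hcont
  refine ⟨σ, hσ', fun a b ha hab => ?_, fun t _ => ?_⟩
  · have hfin' := (finite_limitSwitchings_inter_Ioo (U := U) hσ hN ha hab).subset
      (inter_subset_inter_left _ hdisc)
    rw [ncard_eq_toFinset_card _ hfin']
    exact card_le_of_subset_limitSwitchings hσ hN ha hab _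
      (by simpa using inter_subset_inter_left _ hdisc)
  · filter_upwards [eventually_notMem_of_finite_inter_Iic hfin t] with s hs hs0
    exact hσκ s hs0 hs ▸ hconv s hs0 hs

end LimitSignals

/-! ### Limits of trajectories -/

section LimitCurves

variable {ι E : Type*} [NormedAddCommGroup E] {xs : ι → ℝ → E} {D : Set ℝ} {C : ℝ≥0}

theorem exists_tendsto_of_lipschitzOnWith [ProperSpace E] (U : Ultrafilter ι) {R : ℝ}
    (hR : ∀ k, ∀ t ∈ D, ‖xs k t‖ ≤ R) (hC : ∀ k, LipschitzOnWith C (xs k) D) :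
    ∃ x, LipschitzOnWith C x D ∧ ∀ t ∈ D, Tendsto (fun k => xs k t) U (𝓝 (x t)) := by
  have hlim : ∀ t ∈ D, ∃ e, Tendsto (fun k => xs k t) U (𝓝 e) := by
    intro t ht
    have hball : Metric.closedBall 0 R ∈ U.map fun k => xs k t :=
      show ∀ᶠ k in (U : Filter ι), xs k t ∈ Metric.closedBall 0 R from
        .of_forall fun k => mem_closedBall_zero_iff.2 (hR k t ht)
    obtain ⟨e, -, he⟩ := (isCompact_closedBall (0 : E) R).ultrafilter_le_nhds' _ hball
    exact ⟨e, he⟩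
  choose! x hx using hlim
  refine ⟨x, LipschitzOnWith.of_dist_le_mul fun s hs t ht => ?_, hx⟩
  exact le_of_tendsto ((hx s hs).dist (hx t ht)) (.of_forall fun k => (hC k).dist_le_mul s hs t ht)

theorem tendsto_prod_nhds_of_lipschitzOnWith {l : Filter ι} {t : ℝ} {e : E}
    (hC : ∀ k, LipschitzOnWith C (xs k) D) (hD : D ∈ 𝓝 t)
    (he : Tendsto (fun k => xs k t) l (𝓝 e)) :
    Tendsto (fun q : ι × ℝ => xs q.1 q.2) (l ×ˢ 𝓝 t) (𝓝 e) := by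
  refine (he.comp tendsto_fst).congr_dist (squeeze_zero' (.of_forall fun _ => dist_nonneg)
    (g := fun q : ι × ℝ => C * dist t q.2) ?_ ?_)
  · filter_upwards [tendsto_snd hD] with q hq
      using (hC q.1).dist_le_mul t (mem_of_mem_nhds hD) q.2 hq
  · simpa using ((tendsto_const_nhds (x := t)).dist
      (tendsto_snd (f := l) (g := 𝓝 t))).const_mul (C : ℝ)

end LimitCurves

section LimitTrajectories

variable {ι : Type*} {l : Filter ι} {σs : ι → ℝ → Fin m}
  {xs : ι → ℝ → EuclideanSpace ℝ (Fin n)} {x : ℝ → EuclideanSpace ℝ (Fin n)}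
  {ps : ι → Traj n m} {C : ℝ≥0} {R τ : ℝ} {N : ℕ}

theorem hasDerivAt_of_tendsto_isSolution [l.NeBot] (hf : ∀ γ, Continuous (f γ))
    (hsol : ∀ k, IsSolution f (σs k) (Ici 0) (xs k)) (hC : ∀ k, LipschitzOnWith C (xs k) (Ici 0))
    (hx : ∀ t ∈ Ici 0, Tendsto (fun k => xs k t) l (𝓝 (x t))) {t : ℝ} (ht : 0 < t) {γ : Fin m}
    (hγ : ∀ᶠ q in l ×ˢ 𝓝 t, σs q.1 q.2 = γ) : HasDerivAt x (f γ (x t)) t := by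
  have hγ' : ∀ᶠ q in l ×ˢ 𝓝 t, 0 < q.2 ∧ ∀ᶠ u in 𝓝 q.2, σs q.1 u = γ := by
    obtain ⟨A, hA, W, hW, hAW⟩ := eventually_prod_iff.1 hγ
    exact eventually_prod_iff.2 ⟨A, hA, _, (lt_mem_nhds ht).and hW.eventually_nhds,
      fun hk _ hu => ⟨hu.1, hu.2.mono fun _ => hAW hk⟩⟩
  refine hasDerivAt_of_tendstoUniformlyOnFilter (l := l) (f := xs)
    (f' := fun k u => f γ (xs k u)) (g' := fun _ => f γ (x t)) ?_ ?_ ?_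
  · rw [tendstoUniformlyOnFilter_iff_tendsto]
    exact Uniform.tendsto_nhds_right.1 (((hf γ).tendsto _).comp
      (tendsto_prod_nhds_of_lipschitzOnWith hC (Ici_mem_nhds ht) (hx t ht.le)))
  · filter_upwards [hγ'] with q hq
    rw [← hq.2.self_of_nhds]
    exact (hsol q.1).hasDerivAt (Ici_mem_nhds hq.1)
      (notMem_switchingTimes_of_eventually_eq hq.1 hq.2)
  · filter_upwards [Ici_mem_nhds ht] with u hu using hx u hu

theorem SignalsConverge.isSolution [l.NeBot] (h : SignalsConverge l σs σ)
    (hf : ∀ γ, Continuous (f γ)) (hsol : ∀ k, IsSolution f (σs k) (Ici 0) (xs k))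
    (hC : ∀ k, LipschitzOnWith C (xs k) (Ici 0)) (hxC : LipschitzOnWith C x (Ici 0))
    (hx : ∀ t ∈ Ici 0, Tendsto (fun k => xs k t) l (𝓝 (x t))) : IsSolution f σ (Ici 0) x where
  continuousOn := hxC.continuousOn
  hasDeriv := by
    intro t ht hts
    have ht0 : 0 < t := pos_of_notMem_switchingTimes hts ht
    have hxt : ContinuousAt x t := hxC.continuousOn.continuousAt (Ici_mem_nhds ht0)
    refine (hasDerivAt_of_eventually_hasDerivAt_punctured hxt
      (((hf (σ t)).continuousAt.comp hxt).continuousWithinAt) ?_).hasDerivWithinAt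
    filter_upwards [h t ht, mem_nhdsWithin_of_mem_nhds (lt_mem_nhds ht0),
      mem_nhdsWithin_of_mem_nhds (eventually_eq_of_notMem_switchingTimes hts ht)] with s hs hs0 hσs
    exact hσs ▸ hasDerivAt_of_tendsto_isSolution hf hsol hC hx hs0 (hs hs0)

/-- Convergence of trajectories defined on `[0, ∞)`: the curves converge pointwise, and the signals
converge pointwise at times slightly after any given one. The second condition is the part of
`SignalsConverge` that suffices for closed conditions to pass to the limit. -/
structure TrajsConverge (l : Filter ι) (ps : ι → Traj n m) (p : Traj n m) : Prop where
  tendsto_x : ∀ t, 0 ≤ t → Tendsto (fun k => (ps k).x t) l (𝓝 (p.x t))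
  eventually_σ : ∀ t, 0 ≤ t → ∀ᶠ s in 𝓝[>] t, ∀ᶠ k in l, (ps k).σ s = p.σ t

theorem IsSolution.tendsto_nhdsGT (hx : IsSolution f σ (Ici 0) x) {t : ℝ} (ht : 0 ≤ t) :
    Tendsto x (𝓝[>] t) (𝓝 (x t)) :=
  (hx.continuousOn t ht).mono fun _ hs => ht.trans (le_of_lt hs)

namespace TrajsConverge

variable [l.NeBot] (h : TrajsConverge l ps p) (hx : IsSolution f p.σ (Ici 0) p.x)
include h hx

theorem mem_of_isClosed {A : Set (EuclideanSpace ℝ (Fin n))} (hA : IsClosed A) {t : ℝ}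
    (ht : 0 ≤ t) (hev : ∀ s, t < s → ∀ᶠ k in l, (ps k).σ s = p.σ t → (ps k).x s ∈ A) :
    p.x t ∈ A := by
  refine hA.mem_of_tendsto (hx.tendsto_nhdsGT ht) ?_
  filter_upwards [h.eventually_σ t ht, self_mem_nhdsWithin] with s hσ hts
  exact hA.mem_of_tendsto (h.tendsto_x s (ht.trans (le_of_lt hts)))
    (hσ.mp (hev s hts))

theorem mem_coveredTrajs (hχ : ∀ γ, IsClosed (χ γ)) (hp : p ∈ maximalTrajs f)
    (hps : ∀ k, ps k ∈ coveredTrajs f χ ∧ (ps k).T = ⊤) : p ∈ coveredTrajs f χ := by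
  refine ⟨hp, fun t ht => h.mem_of_isClosed hx (hχ _) ht.1 fun s hts => ?_⟩
  refine .of_forall fun k hσ => hσ ▸ (hps k).1.2 s ?_
  exact Traj.dom_eq_Ici (hps k).2 ▸ ht.1.trans hts.le

theorem mem_nonincreasingTrajs (hV : ∀ γ, Continuous fun ξ => V ξ γ) (hp : p ∈ maximalTrajs f)
    (hps : ∀ k, ps k ∈ nonincreasingTrajs f V ∧ (ps k).T = ⊤) : p ∈ nonincreasingTrajs f V := by
  refine ⟨hp, fun t ht t' ht' htt' hmode => ?_⟩
  rcases htt'.eq_or_lt with rfl | hlt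
  · exact le_rfl
  rw [← hmode]
  have hlim : ∀ {u}, 0 ≤ u → Tendsto (fun s => V (p.x s) (p.σ t)) (𝓝[>] u)
      (𝓝 (V (p.x u) (p.σ t))) := fun hu => ((hV _).tendsto _).comp (hx.tendsto_nhdsGT hu)
  refine ge_of_tendsto (hlim ht.1) ?_
  filter_upwards [h.eventually_σ t ht.1, Ioo_mem_nhdsGT hlt] with s hσ hs
  refine le_of_tendsto (hlim ht'.1) ?_
  filter_upwards [h.eventually_σ t' ht'.1, self_mem_nhdsWithin] with s' hσ' hs'
  have hs0 : 0 ≤ s := ht.1.trans hs.1.le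
  have hss' : s ≤ s' := (hs.2.trans hs').le
  refine le_of_tendsto_of_tendsto (((hV _).tendsto _).comp (h.tendsto_x s' (hs0.trans hss')))
    (((hV _).tendsto _).comp (h.tendsto_x s hs0)) ?_
  filter_upwards [hσ, hσ'] with k hk hk'
  have hdom := Traj.dom_eq_Ici (hps k).2
  have hle := (hps k).1.2 s (hdom ▸ hs0) s' (hdom ▸ hs0.trans hss') hss'
    (by rw [hk, hk', hmode])
  rwa [hk, hk', ← hmode] at hle

end TrajsConverge

theorem exists_trajsConverge (U : Ultrafilter ι) (hf : ∀ γ, Continuous (f γ))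
    (hχ : ∀ γ, IsClosed (χ γ)) (hV : ∀ γ, Continuous fun ξ => V ξ γ)
    (hps : ∀ k, ps k ∈ nonincreasingTrajs f V ∩ coveredTrajs f χ ∩ dwellTrajs f τ N)
    (hT : ∀ k, (ps k).T = ⊤) (hR : ∀ k, ∀ t ∈ Ici 0, ‖(ps k).x t‖ ≤ R) :
    ∃ p ∈ nonincreasingTrajs f V ∩ coveredTrajs f χ ∩ dwellTrajs f τ N,
      p.T = ⊤ ∧ TrajsConverge U ps p := by
  have hσ : ∀ k, IsSwitchingSignal (ps k).σ := fun k => (hps k).2.1.isSwitchingSignal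
  have hsol : ∀ k, IsSolution f (ps k).σ (Ici 0) (ps k).x := fun k =>
    Traj.dom_eq_Ici (hT k) ▸ (hps k).2.1.isSolution
  obtain ⟨C, hC⟩ := exists_nnnorm_le_of_norm_le hf R
  have hlip : ∀ k, LipschitzOnWith C (ps k).x (Ici 0) := fun k =>
    (hsol k).lipschitzOnWith hf (hσ k) ordConnected_Ici Subset.rfl fun t ht => hC _ _ (hR k t ht)
  obtain ⟨x, hxC, hx⟩ := exists_tendsto_of_lipschitzOnWith U hR hlip
  obtain ⟨σ, hσ', hN, hconv⟩ := exists_signalsConverge U hσ fun k => (hps k).2.2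
  have hxsol := hconv.isSolution hf hsol hlip hxC hx
  have hmax : (⟨x, σ, ⊤⟩ : Traj n m) ∈ maximalTrajs f :=
    Traj.isMaximal_of_T_eq_top rfl hσ' hxsol
  have hlim : TrajsConverge U ps ⟨x, σ, ⊤⟩ := ⟨hx, fun t ht => hconv.eventually_eq_right hσ' ht⟩
  exact ⟨⟨x, σ, ⊤⟩, ⟨⟨hlim.mem_nonincreasingTrajs hxsol hV hmax fun k => ⟨(hps k).1.1, hT k⟩,
    hlim.mem_coveredTrajs hxsol hχ hmax fun k => ⟨(hps k).1.2, hT k⟩⟩, hmax, hN⟩, rfl, hlim⟩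

end LimitTrajectories

/-! ### Time shifts -/

section Shift

variable {s t : ℝ}

theorem continuousAt_shift_iff :
    ContinuousAt (fun u => σ (u + s)) t ↔ ContinuousAt σ (t + s) :=
  (Homeomorph.addRight s).isOpenEmbedding.continuousAt_iff

theorem mem_discontinuities_shift_iff (hs : 0 ≤ s) :
    t ∈ discontinuities (fun u => σ (u + s)) ↔ 0 < t ∧ t + s ∈ discontinuities σ := by
  simp only [discontinuities, mem_ofPred_eq, continuousAt_shift_iff]
  exact ⟨fun h => ⟨h.1, add_pos_of_pos_of_nonneg h.1 hs, h.2⟩, fun h => ⟨h.1, h.2.2⟩⟩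

theorem IsSwitchingSignal.shift (hσ : IsSwitchingSignal σ) (hs : 0 ≤ s) :
    IsSwitchingSignal fun u => σ (u + s) where
  right_continuous t ht :=
    (hσ.right_continuous _ (add_nonneg ht hs)).comp (f := fun u => u + s) (by fun_prop)
      fun _ hu => add_le_add_left (mem_Ici.1 hu) s
  locally_finite b :=
    ((hσ.locally_finite (b + s)).preimage (add_left_injective s).injOn).subset fun _ ht =>
      ⟨((mem_discontinuities_shift_iff hs).1 ht.1).2, add_le_add_left (mem_Iic.1 ht.2) s⟩

theorem HasAverageDwellTime.shift {τ : ℝ} {N : ℕ} (h : HasAverageDwellTime τ N σ)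
    (hσ : IsSwitchingSignal σ) (hs : 0 ≤ s) : HasAverageDwellTime τ N fun u => σ (u + s) := by
  intro a b ha hab
  have hfin : (discontinuities σ ∩ Ioo (a + s) (b + s)).Finite :=
    (hσ.locally_finite (b + s)).subset fun _ h => ⟨h.1, h.2.2.le⟩
  have hcard := h (a + s) (b + s) (add_nonneg ha hs) (add_lt_add_left hab s)
  rw [add_sub_add_right_eq_sub] at hcard
  refine (Nat.cast_le.2 ?_).trans hcard
  refine ncard_le_ncard_of_injOn (· + s) (fun t ht => ?_) (add_left_injective s).injOn hfin
  exact ⟨((mem_discontinuities_shift_iff hs).1 ht.1).2, add_lt_add_left ht.2.1 s,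
    add_lt_add_left ht.2.2 s⟩

theorem IsSolution.shift {x : ℝ → EuclideanSpace ℝ (Fin n)} (hx : IsSolution f σ (Ici 0) x)
    (hs : 0 ≤ s) : IsSolution f (fun u => σ (u + s)) (Ici 0) fun u => x (u + s) where
  continuousOn := hx.continuousOn.comp (f := fun u => u + s) (by fun_prop) fun _ hu =>
    add_nonneg (mem_Ici.1 hu) hs
  hasDeriv t ht hts := by
    have ht0 := pos_of_notMem_switchingTimes hts ht
    have hts0 : 0 < t + s := add_pos_of_pos_of_nonneg ht0 hs
    have hts' : t + s ∉ switchingTimes σ := by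
      rintro (h0 | hdisc)
      · exact hts0.ne' h0
      · exact hts (Or.inr ((mem_discontinuities_shift_iff hs).2 ⟨ht0, hdisc⟩))
    exact ((hx.hasDerivAt (Ici_mem_nhds hts0) hts').comp_add_const t s).hasDerivWithinAt

/-- The trajectory restarted at time `s`. The end point `T` is kept, so that this is meaningful
only for trajectories defined on `[0, ∞)`. -/
def Traj.shift (p : Traj n m) (s : ℝ) : Traj n m :=
  ⟨fun t => p.x (t + s), fun t => p.σ (t + s), p.T⟩

theorem Traj.add_mem_dom_of_mem_dom_shift (hT : p.T = ⊤) (hs : 0 ≤ s)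
    (ht : t ∈ (p.shift s).dom) : t + s ∈ p.dom :=
  dom_eq_Ici hT ▸ add_nonneg ht.1 hs

theorem Traj.IsMaximal.shift (hp : p.IsMaximal f) (hT : p.T = ⊤) (hs : 0 ≤ s) :
    (p.shift s).IsMaximal f :=
  isMaximal_of_T_eq_top hT (hp.isSwitchingSignal.shift hs)
    ((dom_eq_Ici hT ▸ hp.isSolution).shift hs)

theorem shift_mem_nonincreasingTrajs (hp : p ∈ nonincreasingTrajs f V) (hT : p.T = ⊤)
    (hs : 0 ≤ s) : p.shift s ∈ nonincreasingTrajs f V :=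
  ⟨hp.1.shift hT hs, fun _ ht _ ht' htt' hmode =>
    hp.2 _ (Traj.add_mem_dom_of_mem_dom_shift hT hs ht) _
      (Traj.add_mem_dom_of_mem_dom_shift hT hs ht') (add_le_add_left htt' s) hmode⟩

theorem shift_mem_coveredTrajs (hp : p ∈ coveredTrajs f χ) (hT : p.T = ⊤) (hs : 0 ≤ s) :
    p.shift s ∈ coveredTrajs f χ :=
  ⟨hp.1.shift hT hs, fun _ ht => hp.2 _ (Traj.add_mem_dom_of_mem_dom_shift hT hs ht)⟩

theorem shift_mem_dwellTrajs {τ : ℝ} {N : ℕ} (hp : p ∈ dwellTrajs f τ N) (hT : p.T = ⊤)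
    (hs : 0 ≤ s) : p.shift s ∈ dwellTrajs f τ N :=
  ⟨hp.1.shift hT hs, hp.2.shift hp.1.isSwitchingSignal hs⟩

theorem shift_mem_constantTrajs (hp : p ∈ constantTrajs f V) (hT : p.T = ⊤) (hs : 0 ≤ s) :
    p.shift s ∈ constantTrajs f V :=
  ⟨shift_mem_nonincreasingTrajs hp.1 hT hs, fun _ ht _ ht' hmode =>
    hp.2 _ (Traj.add_mem_dom_of_mem_dom_shift hT hs ht) _
      (Traj.add_mem_dom_of_mem_dom_shift hT hs ht') hmode⟩

end Shift

/-! ### LaSalle's principle -/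

theorem isWeaklyInvariant_orbit {F : Set (Traj n m)}
    (hF : ∀ s, 0 ≤ s → p.shift s ∈ F) :
    IsWeaklyInvariant F ((fun t => (p.x t, p.σ t)) '' Ici 0) := by
  refine ⟨⟨_, mem_image_of_mem _ self_mem_Ici⟩, ?_⟩
  rintro _ ⟨s, hs, rfl⟩
  refine ⟨p.shift s, hF s hs, by simp [Traj.shift], by simp [Traj.shift], fun t ht => ?_⟩
  exact ⟨t + s, add_nonneg ht.1 hs, rfl⟩

theorem TrajsConverge.mem_constantTrajs {ι : Type*} {l : Filter ι} [l.NeBot] {s : ι → ℝ}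
    {q : Traj n m} (h : TrajsConverge l (fun k => p.shift (s k)) q)
    (hq : q ∈ nonincreasingTrajs f V) (hqT : q.T = ⊤) (hV : ∀ γ, Continuous fun ξ => V ξ γ)
    (hp : p ∈ nonincreasingTrajs f V) (hT : p.T = ⊤) (hs0 : ∀ k, 0 ≤ s k)
    (hs : Tendsto s l atTop) : q ∈ constantTrajs f V := by
  have hx : IsSolution f q.σ (Ici 0) q.x := Traj.dom_eq_Ici hqT ▸ hq.1.isSolution
  have hdom := Traj.dom_eq_Ici hT
  have hle : ∀ t, 0 ≤ t → ∀ u, 0 ≤ u → p.σ u = q.σ t → V (q.x t) (q.σ t) ≤ V (p.x u) (q.σ t) := by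
    intro t ht u hu hmode
    refine h.mem_of_isClosed hx (isClosed_le (hV (q.σ t)) continuous_const) ht fun v htv => ?_
    filter_upwards [hs.eventually_ge_atTop u] with k hk hσ
    have hv : 0 ≤ v := ht.trans htv.le
    have huv : u ≤ v + s k := hk.trans (le_add_of_nonneg_left hv)
    have hV := hp.2 u (hdom ▸ hu) (v + s k) (hdom ▸ hu.trans huv) huv (hmode.trans hσ.symm)
    rwa [hmode, show p.σ (v + s k) = q.σ t from hσ] at hV
  have hle' : ∀ t, 0 ≤ t → ∀ t', 0 ≤ t' → q.σ t = q.σ t' →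
      V (q.x t) (q.σ t) ≤ V (q.x t') (q.σ t) := by
    intro t ht t' ht' hmode
    refine h.mem_of_isClosed hx (isClosed_le continuous_const (hV (q.σ t))) ht' fun v htv => ?_
    refine .of_forall fun k hσ => hle t ht _ (add_nonneg (ht'.trans htv.le) (hs0 k)) ?_
    exact hσ.trans hmode.symm
  refine ⟨hq, fun t ht t' ht' hmode => ?_⟩
  have hge := hle' t' ht'.1 t ht.1 hmode.symm
  rw [← hmode] at hge ⊢
  exact (hle' t ht.1 t' ht'.1 hmode).antisymm hge

section LaSalle

variable {τ : ℝ} {N : ℕ} (hf : ∀ γ, Continuous (f γ)) (hχ : ∀ γ, IsClosed (χ γ))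
  (hV : ∀ γ, Continuous fun ξ => V ξ γ)
  (hG : UniformlyStable (nonincreasingTrajs f V ∩ coveredTrajs f χ))
include hf hχ hV hG

theorem exists_trajsConverge_shift {ι : Type*} (U : Ultrafilter ι) {ps : ι → Traj n m}
    (hps : ∀ k, ps k ∈ nonincreasingTrajs f V ∩ coveredTrajs f χ ∩ dwellTrajs f τ N)
    {s : ι → ℝ} (hs : ∀ k, 0 ≤ s k) {r : ℝ≥0} (hr : ∀ k, ‖(ps k).x (s k)‖₊ ≤ r) :
    ∃ q ∈ nonincreasingTrajs f V ∩ coveredTrajs f χ ∩ dwellTrajs f τ N,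
      q.T = ⊤ ∧ TrajsConverge U (fun k => (ps k).shift (s k)) q := by
  obtain ⟨α, hα, hle⟩ := hG
  have hT : ∀ k, (ps k).T = ⊤ := fun k => (hle _ (hps k).1).1
  refine exists_trajsConverge U hf hχ hV (R := α r) (fun k =>
    ⟨⟨shift_mem_nonincreasingTrajs (hps k).1.1 (hT k) (hs k),
      shift_mem_coveredTrajs (hps k).1.2 (hT k) (hs k)⟩,
      shift_mem_dwellTrajs (hps k).2 (hT k) (hs k)⟩) hT fun k t ht => ?_
  exact ((hle _ (hps k).1).2 (s k) (t + s k) (hs k) (le_add_of_nonneg_left ht)).trans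
    (hα.strictMono.monotone (hr k))

variable (hM : ∀ M, IsWeaklyInvariant
    (constantTrajs f V ∩ coveredTrajs f χ ∩ averageDwellTrajs f) M → M ⊆ {0} ×ˢ univ)
  (hτ : 0 < τ) (hN : 0 < N)
include hM hτ hN

theorem tendsto_zero_of_isWeaklyInvariant_subset
    (hp : p ∈ nonincreasingTrajs f V ∩ coveredTrajs f χ ∩ dwellTrajs f τ N) :
    Tendsto p.x atTop (𝓝 0) := by
  obtain ⟨α, -, hle⟩ := id hG
  obtain ⟨hT, hbdd⟩ := hle p hp.1
  refine (tendsto_iff_ultrafilter _ _ _).2 fun U hU => ?_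
  have hs0 : ∀ s : ℝ, 0 ≤ max s 0 := fun s => le_max_right s 0
  obtain ⟨q, hq, hqT, hlim⟩ := exists_trajsConverge_shift hf hχ hV hG U (fun _ => hp) hs0
    fun s => hbdd 0 _ le_rfl (hs0 s)
  have hqc : q ∈ constantTrajs f V := hlim.mem_constantTrajs hq.1.1 hqT hV hp.1.1 hT hs0
    (tendsto_atTop_mono (fun s => le_max_left s 0) (tendsto_id.mono_left hU))
  have hinv := isWeaklyInvariant_orbit (p := q)
    (F := constantTrajs f V ∩ coveredTrajs f χ ∩ averageDwellTrajs f) fun u hu =>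
      ⟨⟨shift_mem_constantTrajs hqc hqT hu, shift_mem_coveredTrajs hq.1.2 hqT hu⟩, τ, N, hτ, hN,
        shift_mem_dwellTrajs hq.2 hqT hu⟩
  have hq0 : q.x 0 = 0 := (hM _ hinv ⟨0, self_mem_Ici, rfl⟩).1
  refine (hq0 ▸ hlim.tendsto_x 0 le_rfl).congr' ?_
  filter_upwards [hU (eventually_ge_atTop 0)] with s hs
  simp [Traj.shift, max_eq_left hs]

/-- Uniform attractivity of a family: the time in which a ball of radius `r` is steered into a
ball of radius `ε` is the same for all members and all starting times. -/
def UniformlyAttractive (F : Set (Traj n m)) : Prop :=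
  ∀ r ε : ℝ≥0, 0 < ε → ∃ d : ℝ≥0, ∀ p ∈ F, ∀ s t : ℝ, 0 ≤ s → s + d ≤ t → ‖p.x s‖₊ ≤ r →
    ‖p.x t‖₊ ≤ ε

theorem uniformlyAttractive_of_isWeaklyInvariant_subset :
    UniformlyAttractive (nonincreasingTrajs f V ∩ coveredTrajs f χ ∩ dwellTrajs f τ N) := by
  intro r ε hε
  obtain ⟨α, hα, hle⟩ := id hG
  by_contra! hfail
  choose p hp s t hs hst hr hε' using fun k : ℕ => hfail k
  simp only [NNReal.coe_natCast] at hst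
  obtain ⟨δ, rfl⟩ := hα.surjective ε
  have hδ : 0 < δ := pos_iff_ne_zero.2 fun h0 => by simp [h0, hα.map_zero] at hε
  have hfar : ∀ (k : ℕ) (u : ℝ), 0 ≤ u → u ≤ k → δ ≤ ‖((p k).shift (s k)).x u‖₊ := by
    intro k u hu huk
    refine hα.strictMono.le_iff_le.1 ((hε' k).le.trans ?_)
    exact (hle _ (hp k).1).2 (u + s k) (t k) (add_nonneg hu (hs k)) (by linarith [hst k])
  obtain ⟨q, hq, -, hlim⟩ :=
    exists_trajsConverge_shift hf hχ hV hG (hyperfilter ℕ) hp hs hr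
  have hq0 : Tendsto (fun u => ‖q.x u‖₊) atTop (𝓝 0) := by
    simpa using (tendsto_zero_of_isWeaklyInvariant_subset hf hχ hV hG hM hτ hN hq).nnnorm
  refine hδ.not_ge (ge_of_tendsto hq0 ?_)
  filter_upwards [eventually_ge_atTop 0] with u hu
  refine ge_of_tendsto (hlim.tendsto_x u hu).nnnorm (Nat.hyperfilter_le_atTop ?_)
  filter_upwards [tendsto_natCast_atTop_atTop.eventually_ge_atTop u] with k hk
    using hfar k u hu hk

end LaSalle

/-! ### Estimates of class `KL` -/

section Overshoot

variable {F : Set (Traj n m)} {α : ℝ≥0 → ℝ≥0} {r r' d d' : ℝ≥0}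

/-- The supremum of the norms of the members of `F` at times at least `d` after their norm was at
most `r`. It bounds them as soon as they are bounded, for instance if `F` is uniformly stable. -/
noncomputable def overshoot (F : Set (Traj n m)) (r d : ℝ≥0) : ℝ≥0 :=
  sSup {y | ∃ p ∈ F, ∃ s t : ℝ, 0 ≤ s ∧ s + d ≤ t ∧ ‖p.x s‖₊ ≤ r ∧ ‖p.x t‖₊ = y}

theorem overshoot_le {c : ℝ≥0} (h : ∀ p ∈ F, ∀ s t : ℝ, 0 ≤ s → s + d ≤ t → ‖p.x s‖₊ ≤ r →
    ‖p.x t‖₊ ≤ c) : overshoot F r d ≤ c := by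
  refine csSup_le' ?_
  rintro _ ⟨p, hp, s, t, hs, hst, hr, rfl⟩
  exact h p hp s t hs hst hr

theorem UniformlyAttractive.tendsto_overshoot (hF : UniformlyAttractive F) (r : ℝ≥0) :
    Tendsto (overshoot F r) atTop (𝓝 0) := by
  refine tendsto_order.2 ⟨fun a ha => absurd ha not_lt_zero, fun ε hε => ?_⟩
  obtain ⟨δ, hδ, hδε⟩ := exists_between hε
  obtain ⟨d₀, hd₀⟩ := hF r δ hδ
  filter_upwards [eventually_ge_atTop d₀] with d hd
  refine (overshoot_le fun p hp s t hs hst => hd₀ p hp s t hs ?_).trans_lt hδε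
  exact (add_le_add_right (NNReal.coe_le_coe.2 hd) s).trans hst

variable (hα : Monotone α)
  (hle : ∀ p ∈ F, ∀ s t : ℝ, 0 ≤ s → s ≤ t → ‖p.x t‖₊ ≤ α ‖p.x s‖₊)
include hα hle

theorem nnnorm_le_apply_of_nnnorm_le {p : Traj n m} (hp : p ∈ F) {s t : ℝ} (hs : 0 ≤ s)
    (hst : s + d ≤ t) (hr : ‖p.x s‖₊ ≤ r) : ‖p.x t‖₊ ≤ α r :=
  (hle p hp s t hs ((le_add_of_nonneg_right d.2).trans hst)).trans (hα hr)

theorem nnnorm_le_overshoot {p : Traj n m} (hp : p ∈ F) {s t : ℝ} (hs : 0 ≤ s)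
    (hst : s + d ≤ t) (hr : ‖p.x s‖₊ ≤ r) : ‖p.x t‖₊ ≤ overshoot F r d := by
  refine le_csSup ⟨α r, ?_⟩ ⟨p, hp, s, t, hs, hst, hr, rfl⟩
  rintro _ ⟨p, hp, s, t, hs, hst, hr, rfl⟩
  exact nnnorm_le_apply_of_nnnorm_le hα hle hp hs hst hr

theorem overshoot_le_overshoot (hr : r ≤ r') (hd : d' ≤ d) :
    overshoot F r d ≤ overshoot F r' d' :=
  overshoot_le fun _ hp s _ hs hst hrs => nnnorm_le_overshoot hα hle hp hs
    ((add_le_add_right (NNReal.coe_le_coe.2 hd) s).trans hst) (hrs.trans hr)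

end Overshoot

theorem UniformlyAttractive.mono {F G : Set (Traj n m)} (hG : UniformlyAttractive G)
    (h : F ⊆ G) : UniformlyAttractive F := fun r ε hε =>
  let ⟨d, hd⟩ := hG r ε hε
  ⟨d, fun p hp => hd p (h hp)⟩

theorem UniformlyStable.globallyUniformlyAsymptoticallyStable {F : Set (Traj n m)}
    (hF : UniformlyStable F) (hattr : UniformlyAttractive F) :
    GloballyUniformlyAsymptoticallyStable F := by
  obtain ⟨α, hα, hFα⟩ := hF
  have hmono : Monotone α := hα.strictMono.monotone
  have hle := fun p hp => (hFα p hp).2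
  obtain ⟨β, hβ, hφβ⟩ := exists_isClassKL_ge hα (φ := overshoot F)
    (fun d _ _ hr => overshoot_le_overshoot hmono hle hr le_rfl)
    (fun r _ _ hd => overshoot_le_overshoot hmono hle le_rfl hd)
    (fun r d => overshoot_le fun _ hp _ _ => nnnorm_le_apply_of_nnnorm_le hmono hle hp)
    hattr.tendsto_overshoot
  refine ⟨β, hβ, fun p hp => ⟨(hFα p hp).1, fun s t hs hst => ?_⟩⟩
  refine (nnnorm_le_overshoot hmono hle hp hs ?_ le_rfl).trans (hφβ _ _)
  rw [Real.coe_toNNReal _ (sub_nonneg.2 hst), add_sub_cancel]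

end Switched

theorem theorem2_general {n m : ℕ}
    (f : Fin m → EuclideanSpace ℝ (Fin n) → EuclideanSpace ℝ (Fin n))
    (hf : ∀ γ, Continuous (f γ))
    (χ : Fin m → Set (EuclideanSpace ℝ (Fin n)))
    (hχ : ∀ γ, IsClosed (χ γ))
    (F : Set (Switched.Traj n m))
    (hFχ : F ⊆ Switched.coveredTrajs f χ)
    (hFa : F ⊆ Switched.averageDwellTrajs f)
    (V : EuclideanSpace ℝ (Fin n) → Fin m → ℝ)
    (hV : Switched.IsWeakLyapunovLike f χ F V)
    (hM : ∀ M, Switched.IsWeaklyInvariant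
      (Switched.constantTrajs f V ∩ Switched.coveredTrajs f χ ∩ Switched.averageDwellTrajs f) M →
      M ⊆ {0} ×ˢ univ) :
    Switched.GloballyAsymptoticallyStable F ∧
      ∀ (τ : ℝ) (N : ℕ), 0 < τ → 0 < N → F ⊆ Switched.dwellTrajs f τ N →
        Switched.GloballyUniformlyAsymptoticallyStable F := by
  have hVc : ∀ γ, Continuous fun ξ => V ξ γ := fun γ => (hV.contDiff γ).continuous
  obtain ⟨α₁, α₂, hα₁, hα₂, hb⟩ := hV.bounds
  have hG : Switched.UniformlyStable
      (Switched.nonincreasingTrajs f V ∩ Switched.coveredTrajs f χ) :=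
    Switched.uniformlyStable_nonincreasing_inter_covered hf hα₁ hα₂ hb
  have hFG : F ⊆ Switched.nonincreasingTrajs f V ∩ Switched.coveredTrajs f χ :=
    subset_inter (hV.subset_nonincreasingTrajs hFχ) hFχ
  have hF : Switched.UniformlyStable F := hG.mono hFG
  refine ⟨⟨hF, fun p hp => ?_⟩, fun τ N hτ hN hFd => ?_⟩
  · obtain ⟨τ, N, hτ, hN, hpd⟩ := hFa hp
    obtain ⟨α, -, hFα⟩ := hF
    exact ⟨(hFα p hp).1, Switched.tendsto_zero_of_isWeaklyInvariant_subset hf hχ hVc hG hM hτ hN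
      ⟨hFG hp, hpd⟩⟩
  · exact hF.globallyUniformlyAsymptoticallyStable <|
      (Switched.uniformlyAttractive_of_isWeaklyInvariant_subset hf hχ hVc hG hM hτ hN).mono
        (subset_inter hFG hFd)

theorem theorem2 {n m : ℕ}
    (f : Fin m → EuclideanSpace ℝ (Fin n) → EuclideanSpace ℝ (Fin n))
    (hf : ∀ γ, Continuous (f γ))
    (χ : Fin m → Set (EuclideanSpace ℝ (Fin n)))
    (hχ : Switched.IsClosedCovering χ)
    (hf0 : ∀ γ ∈ Switched.zeroModes χ, f γ 0 = 0)
    (F : Set (Switched.Traj n m))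
    (hFχ : F ⊆ Switched.coveredTrajs f χ)
    (hFa : F ⊆ Switched.averageDwellTrajs f)
    (V : EuclideanSpace ℝ (Fin n) → Fin m → ℝ)
    (hV : Switched.IsWeakLyapunovLike f χ F V)
    (hM : Switched.IsMaximalWeaklyInvariant
      (Switched.constantTrajs f V ∩ Switched.coveredTrajs f χ ∩ Switched.averageDwellTrajs f)
      (({0} : Set (EuclideanSpace ℝ (Fin n))) ×ˢ Switched.zeroModes χ)) :
    Switched.GloballyAsymptoticallyStable F ∧
      ∀ (τ : ℝ) (N : ℕ), 0 < τ → 0 < N → F ⊆ Switched.dwellTrajs f τ N →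
        Switched.GloballyUniformlyAsymptoticallyStable F :=
  theorem2_general f hf χ hχ.isClosed F hFχ hFa V hV fun _ h =>
    (hM.2 h).trans (prod_mono_right (subset_univ _))
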